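/- Let $X$ be a complex manifold on which a (discrete) group $G$ acts by holomorphic diffeomorphisms, and let $\mathcal U=(V_a)_{a\in I}$ be a $G$-invariant open covering of $X$, i.e. $G$ acts on $I$ and $V_{ga}=gV_a$ for all $g\in G$, $a\in I$. A *$G$-equivariant holomorphic gerbe* on $X$ (with respect to $\mathcal U$) consists of holomorphic line bundles $L_{a,b}$ on $V_a\cap V_b$ and $L_a(g)$ on $V_a$ ($a,b\in I$, $g\in G$), where $L_{a,a}$ is identified with the trivial bundle and $L_{b,a}$ with the dual of $L_{a,b}$, together with isomorphisms of holomorphic line bundles $$\phi_{a,b,c}\colon L_{a,c}\to L_{a,b}\otimes L_{b,c}\quad\text{on } V_a\cap V_b\cap V_c,$$ $$\phi_{a,b}(g)\colon (g^{-1})^*L_{g^{-1}a,g^{-1}b}\otimes L_b(g)\to L_a(g)\otimes L_{a,b}\quad\text{on } V_a\cap V_b,$$ $$\phi_a(g,h)\colon L_a(gh)\to L_a(g)\otimes (g^{-1})^*L_{g^{-1}a}(h)\quad\text{on } V_a,$$ such that $\phi_{a,b,c}$, viewed as an invertible section of $L_{a,b}\otimes L_{b,c}\otimes L_{c,a}$,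 is skew-symmetric in $a,b,c$ (a transposition of the indices replaces it by its inverse), and such that the following diagrams commute: the two maps $L_{a,d}\to L_{a,b}\otimes L_{b,c}\otimes L_{c,d}$ built from the $\phi_{\cdot,\cdot,\cdot}$ agree on fourfold intersections; the two maps $(g^{-1})^*L_{g^{-1}a,g^{-1}c}\otimes L_c(g)\to L_a(g)\otimes L_{a,b}\otimes L_{b,c}$ agree; the two maps $((gh)^{-1})^*L_{(gh)^{-1}a,(gh)^{-1}b}\otimes L_b(gh)\to L_a(g)\otimes (g^{-1})^*L_{g^{-1}a}(h)\otimes L_{a,b}$ agree; and the two maps $L_a(ghk)\to L_a(g)\otimes (g^{-1})^*L_{g^{-1}a}(h)\otimes((gh)^{-1})^*L_{(gh)^{-1}a}(k)$ agree. An *equivariant hermitian structure* on such a gerbe consists of smooth hermitian metrics on all the line bundles $L_{a,b}$ and $L_a(g)$ such that all the maps $\phi_{a,b,c}$, $\phi_{a,b}(g)$, $\phi_a(g,h)$ are unitary. A *connective structure* consists of smooth complex connections $\nabla_{a,b}$ on $L_{a,b}$ and $\nabla_{a;g}$ on $L_a(g)$ that are compatible with all the maps $\phi_{a,b,c}$,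 $\phi_{a,b}(g)$, $\phi_a(g,h)$ (for the induced connections on pullbacks and tensor products; for instance $\phi_{a,b,c}\circ\nabla_{a,c}=(\nabla_{a,b}\otimes\mathrm{id}+\mathrm{id}\otimes\nabla_{b,c})\circ\phi_{a,b,c}$). It is *compatible* if all the connections $\nabla_{a,b}$, $\nabla_{a;g}$ preserve the hermitian metrics and are compatible with the holomorphic structures (i.e. $\nabla s$ is of type $(1,0)$ for every local holomorphic section $s$). **Theorem.** Every $G$-equivariant holomorphic gerbe with an equivariant hermitian structure possesses a unique compatible connective structure. -/

import Mathlib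

open Bundle Filter Topology TopologicalSpace
open scoped Manifold ContDiff TensorProduct

noncomputable section

universe u v w v₁ v₂ v₃ v₄ w₁ w₂ w₃ w₄

namespace HermGerbe

section Manifold

variable {E : Type u} [NormedAddCommGroup E] [NormedSpace ℂ E]
  {M : Type v} [TopologicalSpace M] [ChartedSpace E M]

/-- A complex manifold is, with the same charts, a smooth real manifold. -/
instance isManifold_real [hM : IsManifold 𝓘(ℂ, E) ω M] : IsManifold 𝓘(ℝ, E) ∞ M := by
  apply isManifold_of_contDiffOn
  intro e e' he he'
  have h := (contDiffGroupoid ω 𝓘(ℂ, E)).compatible he he'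
  rw [contDiffGroupoid, mem_groupoid_of_pregroupoid] at h
  have h2 : ContDiffOn ℂ ω _ _ := h.1
  exact (h2.restrict_scalars ℝ).of_le le_top

/-- The complex structure of the tangent space: multiplication by `i` (in any holomorphic chart;
here, in the preferred chart at `x`, through which Mathlib identifies the tangent space at `x`
with the model space). -/
def tangentI {x : M} (X : TangentSpace 𝓘(ℝ, E) x) : TangentSpace 𝓘(ℝ, E) x :=
  (fun Y : E ↦ Complex.I • Y) X

end Manifold

/-- A holomorphic line bundle on the complex manifold `M`: a holomorphic vector bundle with model
fibre `ℂ`. -/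
structure HolLineBundle (E : Type u) [NormedAddCommGroup E] [NormedSpace ℂ E]
    (M : Type v) [TopologicalSpace M] [ChartedSpace E M] where
  /-- the fibres -/
  Fiber : M → Type w
  [addCommGroup : ∀ x, AddCommGroup (Fiber x)]
  [module : ∀ x, Module ℂ (Fiber x)]
  [topFiber : ∀ x, TopologicalSpace (Fiber x)]
  [topAddGroup : ∀ x, IsTopologicalAddGroup (Fiber x)]
  [contSMul : ∀ x, ContinuousSMul ℂ (Fiber x)]
  [topTotal : TopologicalSpace (TotalSpace ℂ Fiber)]
  [fiberBundle : FiberBundle ℂ Fiber]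
  [vectorBundle : VectorBundle ℂ ℂ Fiber]
  [holomorphic : ContMDiffVectorBundle ω ℂ Fiber 𝓘(ℂ, E)]

attribute [instance] HolLineBundle.addCommGroup HolLineBundle.module HolLineBundle.topFiber
  HolLineBundle.topAddGroup HolLineBundle.contSMul HolLineBundle.topTotal
  HolLineBundle.fiberBundle HolLineBundle.vectorBundle HolLineBundle.holomorphic

namespace HolLineBundle

variable {E : Type u} [NormedAddCommGroup E] [NormedSpace ℂ E]
  {M : Type v} [TopologicalSpace M] [ChartedSpace E M]
  (L : HolLineBundle.{u, v, w} E M)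

instance contSMulReal (x : M) : ContinuousSMul ℝ (L.Fiber x) :=
  IsScalarTower.continuousSMul ℂ

/-- The real vector bundle (with fibre the real plane `ℂ`) underlying a holomorphic line bundle. -/
instance vectorBundleReal : VectorBundle ℝ ℂ L.Fiber where
  trivialization_linear' e he := ⟨fun b hb ↦
    { map_add := (e.linear ℂ hb).map_add
      map_smul := fun c y ↦ by
        have h := (e.linear ℂ hb).map_smul (c : ℂ) y
        simpa using h }⟩
  continuousOn_coordChange' e e' he he' := by
    have h := VectorBundle.continuousOn_coordChange' (R := ℂ) e e'
    refine ((ContinuousLinearMap.restrictScalarsL ℂ ℂ ℂ ℝ ℝ).continuous.comp_continuousOn h).congr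
      fun b hb ↦ ?_
    ext1
    simp [Trivialization.coordChangeL_apply _ _ hb]

/-- The section `s` of `L` is differentiable, in the real sense, at `x`. -/
def DiffAt (s : ∀ y, L.Fiber y) (x : M) : Prop :=
  MDifferentiableAt 𝓘(ℝ, E) (𝓘(ℝ, E).prod 𝓘(ℝ, ℂ)) (fun y ↦ TotalSpace.mk' ℂ y (s y)) x

/-- The section `s` of `L` is smooth (real `C^∞`) on `W`. -/
def SmoothOn (s : ∀ y, L.Fiber y) (W : Set M) : Prop :=
  ContMDiffOn 𝓘(ℝ, E) (𝓘(ℝ, E).prod 𝓘(ℝ, ℂ)) ∞ (fun y ↦ TotalSpace.mk' ℂ y (s y)) W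

/-- For a map `p : N → M` of complex manifolds, the section `s` of the pulled back bundle `p^* L` is
holomorphic near `x`. (A function is analytic at a point iff it is holomorphic near it.) -/
def HolAlong {N : Type v₁} [TopologicalSpace N] [ChartedSpace E N] (p : N → M)
    (s : ∀ y, L.Fiber (p y)) (x : N) : Prop :=
  ContMDiffAt 𝓘(ℂ, E) (𝓘(ℂ, E).prod 𝓘(ℂ, ℂ)) ω (fun y ↦ TotalSpace.mk' ℂ (p y) (s y)) x

/-- The section `s` of `L` is holomorphic near `x`. -/
def HolAt (s : ∀ y, L.Fiber y) (x : M) : Prop := L.HolAlong (fun y ↦ y) s x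

end HolLineBundle

section Isomorphisms

variable {E : Type u} [NormedAddCommGroup E] [NormedSpace ℂ E]
  {N : Type v} [TopologicalSpace N] [ChartedSpace E N]
  {M₁ : Type v₁} [TopologicalSpace M₁] [ChartedSpace E M₁]
  {M₂ : Type v₂} [TopologicalSpace M₂] [ChartedSpace E M₂]
  {M₃ : Type v₃} [TopologicalSpace M₃] [ChartedSpace E M₃]
  {M₄ : Type v₄} [TopologicalSpace M₄] [ChartedSpace E M₄]

/-- A holomorphic isomorphism `p^* A → q^* B ⊗ r^* C` of line bundles on `N`. Holomorphic sections
of a tensor product of two line bundles are those that are locally of the form `s ⊗ t`, with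
holomorphic `s` and `t`. -/
structure TensorIso (p : N → M₁) (A : HolLineBundle.{u, v₁, w₁} E M₁)
    (q : N → M₂) (B : HolLineBundle.{u, v₂, w₂} E M₂)
    (r : N → M₃) (C : HolLineBundle.{u, v₃, w₃} E M₃) where
  /-- the isomorphisms of the fibres -/
  equiv : ∀ x : N, A.Fiber (p x) ≃ₗ[ℂ] B.Fiber (q x) ⊗[ℂ] C.Fiber (r x)
  holomorphic : ∀ (x : N) (u : ∀ y, A.Fiber (p y)), A.HolAlong p u x →
    ∃ (s : ∀ y, B.Fiber (q y)) (t : ∀ y, C.Fiber (r y)), B.HolAlong q s x ∧ C.HolAlong r t x ∧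
      ∀ᶠ y in 𝓝 x, equiv y (u y) = s y ⊗ₜ[ℂ] t y

/-- A holomorphic isomorphism `p^* A ⊗ q^* B → r^* C ⊗ t^* D` of line bundles on `N`. -/
structure TensorIso₂ (p : N → M₁) (A : HolLineBundle.{u, v₁, w₁} E M₁)
    (q : N → M₂) (B : HolLineBundle.{u, v₂, w₂} E M₂)
    (r : N → M₃) (C : HolLineBundle.{u, v₃, w₃} E M₃)
    (t : N → M₄) (D : HolLineBundle.{u, v₄, w₄} E M₄) where
  /-- the isomorphisms of the fibres -/
  equiv : ∀ x : N, A.Fiber (p x) ⊗[ℂ] B.Fiber (q x) ≃ₗ[ℂ] C.Fiber (r x) ⊗[ℂ] D.Fiber (t x)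
  holomorphic : ∀ (x : N) (a : ∀ y, A.Fiber (p y)) (b : ∀ y, B.Fiber (q y)),
    A.HolAlong p a x → B.HolAlong q b x →
    ∃ (c : ∀ y, C.Fiber (r y)) (d : ∀ y, D.Fiber (t y)), C.HolAlong r c x ∧ D.HolAlong t d x ∧
      ∀ᶠ y in 𝓝 x, equiv y (a y ⊗ₜ[ℂ] b y) = c y ⊗ₜ[ℂ] d y

/-- A holomorphic trivialisation `A → N × ℂ`. -/
structure TrivIso (A : HolLineBundle.{u, v, w₁} E N) where
  /-- the isomorphisms of the fibres -/
  equiv : ∀ x : N, A.Fiber x ≃ₗ[ℂ] ℂ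
  holomorphic : ∀ (x : N) (u : ∀ y, A.Fiber y), A.HolAt u x →
    ContMDiffAt 𝓘(ℂ, E) 𝓘(ℂ, ℂ) ω (fun y ↦ equiv y (u y)) x

/-- A holomorphic isomorphism `A ⊗ q^* B → N × ℂ`, identifying `A` with the dual of `q^* B`. -/
structure DualIso (A : HolLineBundle.{u, v, w₁} E N)
    (q : N → M₂) (B : HolLineBundle.{u, v₂, w₂} E M₂) where
  /-- the isomorphisms of the fibres -/
  equiv : ∀ x : N, A.Fiber x ⊗[ℂ] B.Fiber (q x) ≃ₗ[ℂ] ℂ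
  holomorphic : ∀ (x : N) (a : ∀ y, A.Fiber y) (b : ∀ y, B.Fiber (q y)),
    A.HolAt a x → B.HolAlong q b x →
    ContMDiffAt 𝓘(ℂ, E) 𝓘(ℂ, ℂ) ω (fun y ↦ equiv y (a y ⊗ₜ[ℂ] b y)) x

end Isomorphisms

section Hermitian

variable {E : Type u} [NormedAddCommGroup E] [NormedSpace ℂ E]
  {N : Type v} [TopologicalSpace N] [ChartedSpace E N]
  {M₁ : Type v₁} [TopologicalSpace M₁] [ChartedSpace E M₁]
  {M₂ : Type v₂} [TopologicalSpace M₂] [ChartedSpace E M₂]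
  {M₃ : Type v₃} [TopologicalSpace M₃] [ChartedSpace E M₃]
  {M₄ : Type v₄} [TopologicalSpace M₄] [ChartedSpace E M₄]

/-- A smooth hermitian metric on the fibres of a line bundle (antilinear in the first argument). -/
@[ext]
structure HermitianMetric (L : HolLineBundle.{u, v, w} E N) where
  /-- the hermitian forms on the fibres -/
  form : ∀ x, L.Fiber x →ₗ⋆[ℂ] L.Fiber x →ₗ[ℂ] ℂ
  conj_symm : ∀ x a b, starRingEnd ℂ (form x a b) = form x b a
  pos : ∀ x a, a ≠ 0 → 0 < (form x a a).re
  smooth : ∀ (W : Set N), IsOpen W → ∀ s t : ∀ y, L.Fiber y, L.SmoothOn s W → L.SmoothOn t W →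
    ContMDiffOn 𝓘(ℝ, E) 𝓘(ℝ, ℂ) ∞ (fun y ↦ form y (s y) (t y)) W

/-- The sesquilinear form on a tensor product with
`⟨b ⊗ c, b' ⊗ c'⟩ = ⟨b, b'⟩ ⟨c, c'⟩`. -/
def tensorForm {B : Type*} [AddCommGroup B] [Module ℂ B] {C : Type*} [AddCommGroup C] [Module ℂ C]
    (h : B →ₗ⋆[ℂ] B →ₗ[ℂ] ℂ) (k : C →ₗ⋆[ℂ] C →ₗ[ℂ] ℂ) (x y : B ⊗[ℂ] C) : ℂ :=
  ((TensorProduct.lift <| TensorProduct.mapBilinear (.id ℂ) B C ℂ ℂ).compr₂ (.mul' ℂ ℂ) ∘ₛₗ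
    TensorProduct.map h k) x y

@[simp]
theorem tensorForm_tmul {B : Type*} [AddCommGroup B] [Module ℂ B]
    {C : Type*} [AddCommGroup C] [Module ℂ C]
    (h : B →ₗ⋆[ℂ] B →ₗ[ℂ] ℂ) (k : C →ₗ⋆[ℂ] C →ₗ[ℂ] ℂ) (b b' : B) (c c' : C) :
    tensorForm h k (b ⊗ₜ c) (b' ⊗ₜ c') = h b b' * k c c' := rfl

/-- The isomorphism `p^* A → q^* B ⊗ r^* C` is unitary. -/
def TensorIso.IsUnitary {p : N → M₁} {A : HolLineBundle.{u, v₁, w₁} E M₁}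
    {q : N → M₂} {B : HolLineBundle.{u, v₂, w₂} E M₂}
    {r : N → M₃} {C : HolLineBundle.{u, v₃, w₃} E M₃} (φ : TensorIso p A q B r C)
    (hA : HermitianMetric A) (hB : HermitianMetric B) (hC : HermitianMetric C) : Prop :=
  ∀ (x : N) (a a' : A.Fiber (p x)),
    tensorForm (hB.form (q x)) (hC.form (r x)) (φ.equiv x a) (φ.equiv x a') = hA.form (p x) a a'

/-- The isomorphism `p^* A ⊗ q^* B → r^* C ⊗ t^* D` is unitary. -/
def TensorIso₂.IsUnitary {p : N → M₁} {A : HolLineBundle.{u, v₁, w₁} E M₁}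
    {q : N → M₂} {B : HolLineBundle.{u, v₂, w₂} E M₂}
    {r : N → M₃} {C : HolLineBundle.{u, v₃, w₃} E M₃}
    {t : N → M₄} {D : HolLineBundle.{u, v₄, w₄} E M₄} (φ : TensorIso₂ p A q B r C t D)
    (hA : HermitianMetric A) (hB : HermitianMetric B) (hC : HermitianMetric C)
    (hD : HermitianMetric D) : Prop :=
  ∀ (x : N) (z z' : A.Fiber (p x) ⊗[ℂ] B.Fiber (q x)),
    tensorForm (hC.form (r x)) (hD.form (t x)) (φ.equiv x z) (φ.equiv x z') =
      tensorForm (hA.form (p x)) (hB.form (q x)) z z'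

/-- A smooth complex connection on a line bundle: a covariant derivative that satisfies the Leibniz
rule for complex functions and maps smooth local sections to smooth bundle-valued 1-forms.
`toFun s x X` is `∇_X s` at `x`. As a covariant derivative in Mathlib is
a function of all set-theoretic sections, the (meaningless) values at sections that are
not differentiable at the point are normalised to be zero, so that two connections are equal iff
they agree on all sections that can be differentiated. -/
@[ext]
structure Connection [IsManifold 𝓘(ℂ, E) ω N] (L : HolLineBundle.{u, v, w} E N) extends
    CovariantDerivative 𝓘(ℝ, E) ℂ L.Fiber where
  complex_leibniz : ∀ (s : ∀ y, L.Fiber y) (f : N → ℂ) (x : N) (X : TangentSpace 𝓘(ℝ, E) x),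
    L.DiffAt s x → MDifferentiableAt 𝓘(ℝ, E) 𝓘(ℝ, ℂ) f x →
    toFun (fun y ↦ f y • s y) x X = f x • toFun s x X + mvfderiv 𝓘(ℝ, E) f x X • s x
  smooth : ∀ W : Set N, IsOpen W → ContMDiffCovariantDerivativeOn ℂ ∞ toFun W
  eq_zero_of_not_diffAt : ∀ (s : ∀ y, L.Fiber y) (x : N), ¬ L.DiffAt s x → toFun s x = 0

namespace Connection

variable [IsManifold 𝓘(ℂ, E) ω N] {L : HolLineBundle.{u, v, w} E N}

/-- The connection preserves the hermitian metric: `d⟨s, t⟩ = ⟨∇s, t⟩ + ⟨s, ∇t⟩`. -/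
def PreservesMetric (D : Connection L) (h : HermitianMetric L) : Prop :=
  ∀ (s t : ∀ y, L.Fiber y) (x : N) (X : TangentSpace 𝓘(ℝ, E) x), L.DiffAt s x → L.DiffAt t x →
    mvfderiv 𝓘(ℝ, E) (fun y ↦ h.form y (s y) (t y)) x X =
      h.form x (D.toFun s x X) (t x) + h.form x (s x) (D.toFun t x X)

/-- The connection is compatible with the holomorphic structure: its `(0,1)`-part annihilates the
holomorphic sections, i.e. `∇s` is of type `(1,0)` for every local holomorphic section `s`. -/
def IsHolCompatible (D : Connection L) : Prop :=
  ∀ (s : ∀ y, L.Fiber y) (x : N) (X : TangentSpace 𝓘(ℝ, E) x), L.HolAt s x →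
    D.toFun s x (tangentI X) = Complex.I • D.toFun s x X

end Connection

variable [IsManifold 𝓘(ℂ, E) ω M₁] [IsManifold 𝓘(ℂ, E) ω M₂] [IsManifold 𝓘(ℂ, E) ω M₃]
  [IsManifold 𝓘(ℂ, E) ω M₄]

/-- The isomorphism `φ : p^* A → q^* B ⊗ r^* C` (with `p`, `q`, `r` local isomorphisms of complex
manifolds) is compatible with the connections: `φ ∘ ∇ = (∇ ⊗ id + id ⊗ ∇) ∘ φ`. Here a local section
of a pullback is a pullback of a local section, for which `(p^* ∇)_X (p^* s) = ∇_{dp X} s`. -/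
def TensorIso.IsParallel {p : N → M₁} {A : HolLineBundle.{u, v₁, w₁} E M₁}
    {q : N → M₂} {B : HolLineBundle.{u, v₂, w₂} E M₂}
    {r : N → M₃} {C : HolLineBundle.{u, v₃, w₃} E M₃} (φ : TensorIso p A q B r C)
    (DA : Connection A) (DB : Connection B) (DC : Connection C) : Prop :=
  ∀ (x : N) (a : ∀ y, A.Fiber y) (b : ∀ y, B.Fiber y) (c : ∀ y, C.Fiber y),
    A.DiffAt a (p x) → B.DiffAt b (q x) → C.DiffAt c (r x) →
    (∀ᶠ y in 𝓝 x, φ.equiv y (a (p y)) = b (q y) ⊗ₜ[ℂ] c (r y)) →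
    ∀ X : TangentSpace 𝓘(ℝ, E) x,
      φ.equiv x (DA.toFun a (p x) (mfderiv 𝓘(ℝ, E) 𝓘(ℝ, E) p x X)) =
        DB.toFun b (q x) (mfderiv 𝓘(ℝ, E) 𝓘(ℝ, E) q x X) ⊗ₜ[ℂ] c (r x) +
          b (q x) ⊗ₜ[ℂ] DC.toFun c (r x) (mfderiv 𝓘(ℝ, E) 𝓘(ℝ, E) r x X)

/-- The isomorphism `φ : p^* A ⊗ q^* B → r^* C ⊗ t^* D` (with `p`, `q`, `r`, `t` local isomorphisms
of complex manifolds) is compatible with the connections: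
`φ ∘ (∇ ⊗ id + id ⊗ ∇) = (∇ ⊗ id + id ⊗ ∇) ∘ φ`. -/
def TensorIso₂.IsParallel {p : N → M₁} {A : HolLineBundle.{u, v₁, w₁} E M₁}
    {q : N → M₂} {B : HolLineBundle.{u, v₂, w₂} E M₂}
    {r : N → M₃} {C : HolLineBundle.{u, v₃, w₃} E M₃}
    {t : N → M₄} {D : HolLineBundle.{u, v₄, w₄} E M₄} (φ : TensorIso₂ p A q B r C t D)
    (DA : Connection A) (DB : Connection B) (DC : Connection C) (DD : Connection D) : Prop :=
  ∀ (x : N) (a : ∀ y, A.Fiber y) (b : ∀ y, B.Fiber y) (c : ∀ y, C.Fiber y) (d : ∀ y, D.Fiber y),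
    A.DiffAt a (p x) → B.DiffAt b (q x) → C.DiffAt c (r x) → D.DiffAt d (t x) →
    (∀ᶠ y in 𝓝 x, φ.equiv y (a (p y) ⊗ₜ[ℂ] b (q y)) = c (r y) ⊗ₜ[ℂ] d (t y)) →
    ∀ X : TangentSpace 𝓘(ℝ, E) x,
      φ.equiv x (DA.toFun a (p x) (mfderiv 𝓘(ℝ, E) 𝓘(ℝ, E) p x X) ⊗ₜ[ℂ] b (q x) +
          a (p x) ⊗ₜ[ℂ] DB.toFun b (q x) (mfderiv 𝓘(ℝ, E) 𝓘(ℝ, E) q x X)) =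
        DC.toFun c (r x) (mfderiv 𝓘(ℝ, E) 𝓘(ℝ, E) r x X) ⊗ₜ[ℂ] d (t x) +
          c (r x) ⊗ₜ[ℂ] DD.toFun d (t x) (mfderiv 𝓘(ℝ, E) 𝓘(ℝ, E) t x X)

end Hermitian

section Gerbe

variable (E : Type u) [NormedAddCommGroup E] [NormedSpace ℂ E]
  {X : Type v} [TopologicalSpace X] [ChartedSpace E X]
  {I : Type v₂}

/-- The inclusion of a triple intersection into the intersection of the first two sets. -/
def res₁₂ (V : I → Opens X) (a b c : I) (x : ↥(V a ⊓ V b ⊓ V c)) : ↥(V a ⊓ V b) :=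
  ⟨x.1, x.2.1⟩

/-- The inclusion of a triple intersection into the intersection of the last two sets. -/
def res₂₃ (V : I → Opens X) (a b c : I) (x : ↥(V a ⊓ V b ⊓ V c)) : ↥(V b ⊓ V c) :=
  ⟨x.1, x.2.1.2, x.2.2⟩

/-- The inclusion of a triple intersection into the intersection of the first and the last set. -/
def res₁₃ (V : I → Opens X) (a b c : I) (x : ↥(V a ⊓ V b ⊓ V c)) : ↥(V a ⊓ V c) :=
  ⟨x.1, x.2.1.1, x.2.2⟩

/-- The inclusion of an intersection into the first set. -/
def res₁ (V : I → Opens X) (a b : I) (x : ↥(V a ⊓ V b)) : ↥(V a) := ⟨x.1, x.2.1⟩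

/-- The inclusion of an intersection into the second set. -/
def res₂ (V : I → Opens X) (a b : I) (x : ↥(V a ⊓ V b)) : ↥(V b) := ⟨x.1, x.2.2⟩

/-- The identification of `V b ⊓ V a` with `V a ⊓ V b`. -/
def swapInter (V : I → Opens X) (a b : I) (x : ↥(V a ⊓ V b)) : ↥(V b ⊓ V a) := ⟨x.1, x.2.2, x.2.1⟩

/-- The transition bundles `L a b` on `V a ∩ V b` of a gerbe, with the structure maps
`φ a b c : L a c → L a b ⊗ L b c` on triple intersections and the identifications of `L a a` with
the trivial bundle and of `L b a` with the dual of `L a b`. -/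
structure GerbeData (V : I → Opens X) where
  /-- the transition bundles -/
  L : ∀ a b, HolLineBundle.{u, v, w} E ↥(V a ⊓ V b)
  /-- the structure maps -/
  φ : ∀ a b c, TensorIso (res₁₃ V a b c) (L a c) (res₁₂ V a b c) (L a b) (res₂₃ V a b c) (L b c)
  /-- `L a a` is trivial -/
  triv : ∀ a, TrivIso (L a a)
  /-- `L b a` is dual to `L a b` -/
  dual : ∀ a b, DualIso (L a b) (swapInter V a b) (L b a)

namespace GerbeData

variable {E} {V : I → Opens X} (𝒢 : GerbeData.{u, v, w} E V)

/-- The fibre of `L a b` at a point of `X`. -/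
abbrev LAt (a b : I) (x : X) (ha : x ∈ V a) (hb : x ∈ V b) : Type w := (𝒢.L a b).Fiber ⟨x, ha, hb⟩

/-- The structure map `φ a b c` at a point of `X`. -/
def φAt (a b c : I) (x : X) (ha : x ∈ V a) (hb : x ∈ V b) (hc : x ∈ V c) :
    𝒢.LAt a c x ha hc ≃ₗ[ℂ] 𝒢.LAt a b x ha hb ⊗[ℂ] 𝒢.LAt b c x hb hc :=
  (𝒢.φ a b c).equiv ⟨x, ⟨ha, hb⟩, hc⟩

/-- The trivialisation of `L a a` at a point of `X`. -/
def trivAt (a : I) (x : X) (ha : x ∈ V a) : 𝒢.LAt a a x ha ha ≃ₗ[ℂ] ℂ :=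
  (𝒢.triv a).equiv ⟨x, ha, ha⟩

/-- The duality pairing of `L a b` and `L b a` at a point of `X`. -/
def dualAt (a b : I) (x : X) (ha : x ∈ V a) (hb : x ∈ V b) :
    𝒢.LAt a b x ha hb ⊗[ℂ] 𝒢.LAt b a x hb ha ≃ₗ[ℂ] ℂ :=
  (𝒢.dual a b).equiv ⟨x, ha, hb⟩

end GerbeData

/-- A holomorphic gerbe, given by transition bundles with respect to the open sets `V a`. -/
structure HolGerbe (V : I → Opens X) extends GerbeData.{u, v, w} E V where
  /-- coassociativity: `(φ_{abc} ⊗ id) ∘ φ_{acd} = (id ⊗ φ_{bcd}) ∘ φ_{abd}` -/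
  coassoc : ∀ (a b c d : I) (x : X) (ha : x ∈ V a) (hb : x ∈ V b) (hc : x ∈ V c) (hd : x ∈ V d)
    (l : toGerbeData.LAt a d x ha hd),
    TensorProduct.assoc ℂ _ _ _ (TensorProduct.map (toGerbeData.φAt a b c x ha hb hc).toLinearMap
      LinearMap.id (toGerbeData.φAt a c d x ha hc hd l)) =
    TensorProduct.map LinearMap.id (toGerbeData.φAt b c d x hb hc hd).toLinearMap
      (toGerbeData.φAt a b d x ha hb hd l)
  /-- the duality pairings of `L a b` with `L b a` and of `L b a` with `L a b` are the same -/
  dual_symm : ∀ (a b : I) (x : X) (ha : x ∈ V a) (hb : x ∈ V b)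
    (l : toGerbeData.LAt a b x ha hb) (l' : toGerbeData.LAt b a x hb ha),
    toGerbeData.dualAt a b x ha hb (l ⊗ₜ l') = toGerbeData.dualAt b a x hb ha (l' ⊗ₜ l)
  /-- the trivial bundle `L a a` is dual to itself in the obvious way -/
  dual_self : ∀ (a : I) (x : X) (ha : x ∈ V a) (l l' : toGerbeData.LAt a a x ha ha),
    toGerbeData.dualAt a a x ha ha (l ⊗ₜ l') =
      toGerbeData.trivAt a x ha l * toGerbeData.trivAt a x ha l'
  /-- skew-symmetry of `φ` in the first two indices: the contraction of `φ_{abc}` and `φ_{bac}`,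
  viewed as sections of `L a b ⊗ L b c ⊗ L c a` and `L b a ⊗ L a c ⊗ L c b`, is one; that is,
  `L a c → L a b ⊗ L b c → L a b ⊗ (L b a ⊗ L a c) → L a c` is the identity. -/
  skew₁₂ : ∀ (a b c : I) (x : X) (ha : x ∈ V a) (hb : x ∈ V b) (hc : x ∈ V c)
    (l : toGerbeData.LAt a c x ha hc),
    TensorProduct.lid ℂ _ (TensorProduct.map (toGerbeData.dualAt a b x ha hb).toLinearMap
      LinearMap.id ((TensorProduct.assoc ℂ _ _ _).symm
        (TensorProduct.map LinearMap.id (toGerbeData.φAt b a c x hb ha hc).toLinearMap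
          (toGerbeData.φAt a b c x ha hb hc l)))) = l
  /-- skew-symmetry of `φ` in the last two indices: the contraction of `φ_{abc}` and `φ_{acb}`,
  viewed as sections of `L a b ⊗ L b c ⊗ L c a` and `L a c ⊗ L c b ⊗ L b a`, is one; that is,
  `L a c → L a b ⊗ L b c → (L a c ⊗ L c b) ⊗ L b c → L a c` is the identity. -/
  skew₂₃ : ∀ (a b c : I) (x : X) (ha : x ∈ V a) (hb : x ∈ V b) (hc : x ∈ V c)
    (l : toGerbeData.LAt a c x ha hc),
    TensorProduct.rid ℂ _ (TensorProduct.map LinearMap.id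
      (toGerbeData.dualAt c b x hc hb).toLinearMap (TensorProduct.assoc ℂ _ _ _
        (TensorProduct.map (toGerbeData.φAt a c b x ha hc hb).toLinearMap LinearMap.id
          (toGerbeData.φAt a b c x ha hb hc l)))) = l

end Gerbe

section Cover

variable {G : Type v₁} [Group G] {X : Type v} [TopologicalSpace X] [MulAction G X]
  {I : Type v₂} [MulAction G I]

variable (G X I) in
/-- A `G`-invariant open covering of `X`: the group acts on the index set `I` such that
`V (g a) = g V a`. -/
structure InvariantCover where
  /-- the open sets -/
  V : I → Opens X
  covers : ∀ x, ∃ a, x ∈ V a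
  smul_eq : ∀ (g : G) (a : I), (V (g • a) : Set X) = (fun x ↦ g • x) '' (V a : Set X)

theorem InvariantCover.inv_mem (𝒰 : InvariantCover G X I) (g : G) {a : I} {x : X}
    (hx : x ∈ 𝒰.V a) : g⁻¹ • x ∈ 𝒰.V (g⁻¹ • a) := by
  have h : g⁻¹ • x ∈ (𝒰.V (g⁻¹ • a) : Set X) := 𝒰.smul_eq g⁻¹ a ▸ ⟨x, hx, rfl⟩
  exact h

/-- The map `V a → V (g⁻¹ a)`, `x ↦ g⁻¹ x`. -/
def translate (𝒰 : InvariantCover G X I) (g : G) (a : I) (x : ↥(𝒰.V a)) : ↥(𝒰.V (g⁻¹ • a)) :=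
  ⟨g⁻¹ • x.1, 𝒰.inv_mem g x.2⟩

/-- The map `V a ∩ V b → V (g⁻¹ a) ∩ V (g⁻¹ b)`, `x ↦ g⁻¹ x`. -/
def translate₂ (𝒰 : InvariantCover G X I) (g : G) (a b : I) (x : ↥(𝒰.V a ⊓ 𝒰.V b)) :
    ↥(𝒰.V (g⁻¹ • a) ⊓ 𝒰.V (g⁻¹ • b)) :=
  ⟨g⁻¹ • x.1, 𝒰.inv_mem g x.2.1, 𝒰.inv_mem g x.2.2⟩

end Cover

section EquivariantGerbe

variable (E : Type u) [NormedAddCommGroup E] [NormedSpace ℂ E]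
  {G : Type v₁} [Group G] {X : Type v} [TopologicalSpace X] [ChartedSpace E X] [MulAction G X]
  {I : Type v₂} [MulAction G I]

/-- A holomorphic gerbe with the additional line bundles `Lg g a` (written `L_a(g)`) on `V a` and
structure maps
`φ₁ g a b : (g⁻¹)^* L (g⁻¹ a) (g⁻¹ b) ⊗ Lg g b → Lg g a ⊗ L a b` on `V a ∩ V b`,
`φ₂ g h a : Lg (g h) a → Lg g a ⊗ (g⁻¹)^* Lg h (g⁻¹ a)` on `V a`. -/
structure EquivariantGerbeData (𝒰 : InvariantCover G X I) extends HolGerbe.{u, v, w} E 𝒰.V where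
  /-- the line bundles `L_a(g)` -/
  Lg : G → ∀ a : I, HolLineBundle.{u, v, w} E ↥(𝒰.V a)
  /-- the structure maps `φ_{a,b}(g)` -/
  φ₁ : ∀ (g : G) (a b : I),
    TensorIso₂ (translate₂ 𝒰 g a b) (L (g⁻¹ • a) (g⁻¹ • b)) (res₂ 𝒰.V a b) (Lg g b)
      (res₁ 𝒰.V a b) (Lg g a) id (L a b)
  /-- the structure maps `φ_a(g,h)` -/
  φ₂ : ∀ (g h : G) (a : I),
    TensorIso id (Lg (g * h) a) id (Lg g a) (translate 𝒰 g a) (Lg h (g⁻¹ • a))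

namespace EquivariantGerbeData

variable {E} {𝒰 : InvariantCover G X I} (𝒢 : EquivariantGerbeData.{u, v, w} E 𝒰)

/-- The fibre of `Lg g a` at a point of `X`. -/
abbrev LgAt (g : G) (a : I) (x : X) (ha : x ∈ 𝒰.V a) : Type w := (𝒢.Lg g a).Fiber ⟨x, ha⟩

/-- The structure map `φ_{a,b}(g)` at a point of `X`. -/
def φ₁At (g : G) (a b : I) (x : X) (ha : x ∈ 𝒰.V a) (hb : x ∈ 𝒰.V b) :
    𝒢.LAt (g⁻¹ • a) (g⁻¹ • b) (g⁻¹ • x) (𝒰.inv_mem g ha) (𝒰.inv_mem g hb) ⊗[ℂ] 𝒢.LgAt g b x hb ≃ₗ[ℂ]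
      𝒢.LgAt g a x ha ⊗[ℂ] 𝒢.LAt a b x ha hb :=
  (𝒢.φ₁ g a b).equiv ⟨x, ha, hb⟩

/-- The structure map `φ_a(g,h)` at a point of `X`. -/
def φ₂At (g h : G) (a : I) (x : X) (ha : x ∈ 𝒰.V a) :
    𝒢.LgAt (g * h) a x ha ≃ₗ[ℂ]
      𝒢.LgAt g a x ha ⊗[ℂ] 𝒢.LgAt h (g⁻¹ • a) (g⁻¹ • x) (𝒰.inv_mem g ha) :=
  (𝒢.φ₂ g h a).equiv ⟨x, ha⟩

/-- The identity map between two fibres with equal indices. -/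
def castL {a a' b b' : I} {x x' : X} (h₁ : a = a') (h₂ : b = b') (h₃ : x = x')
    (ha : x ∈ 𝒰.V a) (hb : x ∈ 𝒰.V b) (ha' : x' ∈ 𝒰.V a') (hb' : x' ∈ 𝒰.V b') :
    𝒢.LAt a b x ha hb ≃ₗ[ℂ] 𝒢.LAt a' b' x' ha' hb' := by
  subst h₁ h₂ h₃
  exact LinearEquiv.refl ℂ _

/-- The identity map between two fibres with equal indices. -/
def castLg {g g' : G} {a a' : I} {x x' : X} (h₁ : g = g') (h₂ : a = a') (h₃ : x = x')
    (ha : x ∈ 𝒰.V a) (ha' : x' ∈ 𝒰.V a') :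
    𝒢.LgAt g a x ha ≃ₗ[ℂ] 𝒢.LgAt g' a' x' ha' := by
  subst h₁ h₂ h₃
  exact LinearEquiv.refl ℂ _

end EquivariantGerbeData

/-- A `G`-equivariant holomorphic gerbe: the structure maps obey the natural coherence conditions
(which, for trivial line bundles, are the 2-cocycle conditions of the group-Čech complex). -/
structure EquivariantGerbe (𝒰 : InvariantCover G X I) extends
    EquivariantGerbeData.{u, v, w} E 𝒰 where
  /-- The two maps `L_a(ghk) → L_a(g) ⊗ (g⁻¹)^* L_{g⁻¹a}(h) ⊗ ((gh)⁻¹)^* L_{(gh)⁻¹a}(k)`, through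
  `L_a(gh)` and through `L_{g⁻¹a}(hk)`, are equal. -/
  coherence₂₀ : ∀ (g h k : G) (a : I) (x : X) (ha : x ∈ 𝒰.V a)
    (l : toEquivariantGerbeData.LgAt (g * h * k) a x ha),
    TensorProduct.map LinearMap.id (TensorProduct.map LinearMap.id
      (toEquivariantGerbeData.castLg (g := k) rfl
        (by rw [mul_inv_rev, mul_smul]) (by rw [mul_inv_rev, mul_smul])
        (𝒰.inv_mem (g * h) ha) (𝒰.inv_mem h (𝒰.inv_mem g ha))).toLinearMap)
      (TensorProduct.assoc ℂ _ _ _ (TensorProduct.map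
        (toEquivariantGerbeData.φ₂At g h a x ha).toLinearMap LinearMap.id
        (toEquivariantGerbeData.φ₂At (g * h) k a x ha l))) =
    TensorProduct.map LinearMap.id
      (toEquivariantGerbeData.φ₂At h k (g⁻¹ • a) (g⁻¹ • x) (𝒰.inv_mem g ha)).toLinearMap
      (toEquivariantGerbeData.φ₂At g (h * k) a x ha
        (toEquivariantGerbeData.castLg (mul_assoc g h k) rfl rfl ha ha l))
  /-- The two maps `(g⁻¹)^* L_{g⁻¹a,g⁻¹c} ⊗ L_c(g) → L_a(g) ⊗ L_{a,b} ⊗ L_{b,c}`, given by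
  `φ_{a,c}(g)` and `φ_{a,b,c}` and by `φ_{g⁻¹a,g⁻¹b,g⁻¹c}`, `φ_{b,c}(g)` and `φ_{a,b}(g)`,
  are equal. -/
  coherence₀₂ : ∀ (g : G) (a b c : I) (x : X) (ha : x ∈ 𝒰.V a) (hb : x ∈ 𝒰.V b) (hc : x ∈ 𝒰.V c)
    (z : toEquivariantGerbeData.LAt (g⁻¹ • a) (g⁻¹ • c) (g⁻¹ • x)
      (𝒰.inv_mem g ha) (𝒰.inv_mem g hc) ⊗[ℂ] toEquivariantGerbeData.LgAt g c x hc),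
    TensorProduct.map LinearMap.id (toEquivariantGerbeData.φAt a b c x ha hb hc).toLinearMap
      (toEquivariantGerbeData.φ₁At g a c x ha hc z) =
    TensorProduct.assoc ℂ _ _ _
      (TensorProduct.map (toEquivariantGerbeData.φ₁At g a b x ha hb).toLinearMap LinearMap.id
        ((TensorProduct.assoc ℂ _ _ _).symm
          (TensorProduct.map LinearMap.id
            (toEquivariantGerbeData.φ₁At g b c x hb hc).toLinearMap
            (TensorProduct.assoc ℂ _ _ _
              (TensorProduct.map (toEquivariantGerbeData.φAt (g⁻¹ • a) (g⁻¹ • b) (g⁻¹ • c)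
                (g⁻¹ • x) (𝒰.inv_mem g ha) (𝒰.inv_mem g hb) (𝒰.inv_mem g hc)).toLinearMap
                LinearMap.id z)))))
  /-- The two maps
  `((gh)⁻¹)^* L_{(gh)⁻¹a,(gh)⁻¹b} ⊗ L_b(gh) → L_a(g) ⊗ (g⁻¹)^* L_{g⁻¹a}(h) ⊗ L_{a,b}`, given by
  `φ_{a,b}(gh)` and `φ_a(g,h)` and by `φ_b(g,h)`, `φ_{g⁻¹a,g⁻¹b}(h)` and `φ_{a,b}(g)`,
  are equal. -/
  coherence₁₁ : ∀ (g h : G) (a b : I) (x : X) (ha : x ∈ 𝒰.V a) (hb : x ∈ 𝒰.V b)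
    (z : toEquivariantGerbeData.LAt ((g * h)⁻¹ • a) ((g * h)⁻¹ • b) ((g * h)⁻¹ • x)
      (𝒰.inv_mem (g * h) ha) (𝒰.inv_mem (g * h) hb) ⊗[ℂ]
        toEquivariantGerbeData.LgAt (g * h) b x hb),
    TensorProduct.map (toEquivariantGerbeData.φ₂At g h a x ha).toLinearMap LinearMap.id
      (toEquivariantGerbeData.φ₁At (g * h) a b x ha hb z) =
    TensorProduct.map (TensorProduct.comm ℂ _ _).toLinearMap LinearMap.id
      ((TensorProduct.assoc ℂ _ _ _).symm
        (TensorProduct.map LinearMap.id (toEquivariantGerbeData.φ₁At g a b x ha hb).toLinearMap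
          (TensorProduct.assoc ℂ _ _ _
            (TensorProduct.map
              (toEquivariantGerbeData.φ₁At h (g⁻¹ • a) (g⁻¹ • b) (g⁻¹ • x)
                (𝒰.inv_mem g ha) (𝒰.inv_mem g hb)).toLinearMap LinearMap.id
              ((TensorProduct.assoc ℂ _ _ _).symm
                (TensorProduct.map
                  (toEquivariantGerbeData.castL (by rw [mul_inv_rev, mul_smul])
                    (by rw [mul_inv_rev, mul_smul]) (by rw [mul_inv_rev, mul_smul])
                    (𝒰.inv_mem (g * h) ha) (𝒰.inv_mem (g * h) hb)
                    (𝒰.inv_mem h (𝒰.inv_mem g ha)) (𝒰.inv_mem h (𝒰.inv_mem g hb))).toLinearMap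
                  ((TensorProduct.comm ℂ _ _).toLinearMap ∘ₗ
                    (toEquivariantGerbeData.φ₂At g h b x hb).toLinearMap) z))))))

variable {E}
variable {𝒰 : InvariantCover G X I}

/-- An equivariant hermitian structure on an equivariant holomorphic gerbe: hermitian metrics on the
line bundles `L_{a,b}` and `L_a(g)` such that the structure maps are unitary. -/
structure EquivariantHermitianStructure (𝒢 : EquivariantGerbe.{u, v, w} E 𝒰) where
  /-- the metrics on the transition bundles -/
  metric : ∀ a b, HermitianMetric (𝒢.L a b)
  /-- the metrics on the line bundles `L_a(g)` -/
  metricG : ∀ g a, HermitianMetric (𝒢.Lg g a)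
  unitary₀ : ∀ a b c, (𝒢.φ a b c).IsUnitary (metric a c) (metric a b) (metric b c)
  unitary₁ : ∀ g a b, (𝒢.φ₁ g a b).IsUnitary (metric (g⁻¹ • a) (g⁻¹ • b)) (metricG g b)
    (metricG g a) (metric a b)
  unitary₂ : ∀ g h a, (𝒢.φ₂ g h a).IsUnitary (metricG (g * h) a) (metricG g a)
    (metricG h (g⁻¹ • a))

/-- An (equivariant) connective structure on an equivariant holomorphic gerbe: smooth complex
connections on the line bundles `L_{a,b}` and `L_a(g)` that are compatible with the structure
maps. -/
structure ConnectiveStructure [IsManifold 𝓘(ℂ, E) ω X] (𝒢 : EquivariantGerbe.{u, v, w} E 𝒰) where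
  /-- the connections on the transition bundles -/
  conn : ∀ a b, Connection (𝒢.L a b)
  /-- the connections on the line bundles `L_a(g)` -/
  connG : ∀ g a, Connection (𝒢.Lg g a)
  parallel₀ : ∀ a b c, (𝒢.φ a b c).IsParallel (conn a c) (conn a b) (conn b c)
  parallel₁ : ∀ g a b, (𝒢.φ₁ g a b).IsParallel (conn (g⁻¹ • a) (g⁻¹ • b)) (connG g b)
    (connG g a) (conn a b)
  parallel₂ : ∀ g h a, (𝒢.φ₂ g h a).IsParallel (connG (g * h) a) (connG g a)
    (connG h (g⁻¹ • a))

/-- The connections of the connective structure preserve the hermitian structure and are compatible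
with the holomorphic structure. -/
structure ConnectiveStructure.IsCompatible [IsManifold 𝓘(ℂ, E) ω X]
    {𝒢 : EquivariantGerbe.{u, v, w} E 𝒰} (D : ConnectiveStructure 𝒢)
    (h : EquivariantHermitianStructure 𝒢) : Prop where
  preservesMetric : ∀ a b, (D.conn a b).PreservesMetric (h.metric a b)
  preservesMetricG : ∀ g a, (D.connG g a).PreservesMetric (h.metricG g a)
  holCompatible : ∀ a b, (D.conn a b).IsHolCompatible
  holCompatibleG : ∀ g a, (D.connG g a).IsHolCompatible

end EquivariantGerbe

end HermGerbe

/-!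
The connections are forced: a hermitian holomorphic line bundle has exactly one connection that
preserves the metric and is compatible with the holomorphic structure, its Chern connection, which
in a holomorphic frame of square length `H` is `d + ∂ log H`. The form `∂ log H` is natural under
holomorphic pullback, turns products into sums, so that tensor products of Chern connections are
Chern, and changes by `dk / k` when the frame is multiplied by a holomorphic function `k`, because
`∂` kills the conjugate of `k`. Hence every unitary holomorphic isomorphism between pullbacks and
tensor products of hermitian line bundles is automatically parallel, so the Chern connections form
a connective structure.
-/

namespace HermGerbe

section ComplexCalculus

variable {E : Type*} [NormedAddCommGroup E] [NormedSpace ℂ E]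
  {E' : Type*} [NormedAddCommGroup E'] [NormedSpace ℂ E']
  {M : Type*} [TopologicalSpace M] [ChartedSpace E M]
  {N : Type*} [TopologicalSpace N] [ChartedSpace E' N]

theorem contMDiffWithinAt_restrictScalars {f : M → N} {s : Set M} {x : M}
    (hf : ContMDiffWithinAt 𝓘(ℂ, E) 𝓘(ℂ, E') ω f s x) :
    ContMDiffWithinAt 𝓘(ℝ, E) 𝓘(ℝ, E') ∞ f s x := by
  rw [contMDiffWithinAt_iff] at hf ⊢
  exact ⟨hf.1, (ContDiffWithinAt.restrict_scalars ℝ hf.2).of_le le_top⟩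

theorem hasMFDerivAt_restrictScalars {f : M → N} {x : M} {T : E →L[ℂ] E'}
    (hf : HasMFDerivAt 𝓘(ℂ, E) 𝓘(ℂ, E') f x T) :
    HasMFDerivAt 𝓘(ℝ, E) 𝓘(ℝ, E') f x (T.restrictScalars ℝ) :=
  ⟨hf.1, HasFDerivWithinAt.restrictScalars ℝ (f' := T) hf.2⟩

theorem mdifferentiableAt_restrictScalars {f : M → N} {x : M}
    (hf : MDifferentiableAt 𝓘(ℂ, E) 𝓘(ℂ, E') f x) : MDifferentiableAt 𝓘(ℝ, E) 𝓘(ℝ, E') f x :=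
  (hasMFDerivAt_restrictScalars hf.hasMFDerivAt).mdifferentiableAt

theorem tangentI_tangentI {x : M} (X : TangentSpace 𝓘(ℝ, E) x) : tangentI (tangentI X) = -X := by
  change Complex.I • Complex.I • (show E from X) = -(show E from X)
  rw [smul_smul, Complex.I_mul_I, neg_one_smul]

theorem mfderiv_tangentI {f : M → N} {x : M} (hf : MDifferentiableAt 𝓘(ℂ, E) 𝓘(ℂ, E') f x)
    (X : TangentSpace 𝓘(ℝ, E) x) :
    mfderiv 𝓘(ℝ, E) 𝓘(ℝ, E') f x (tangentI X) = tangentI (mfderiv 𝓘(ℝ, E) 𝓘(ℝ, E') f x X) := by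
  let T : E →L[ℂ] E' := mfderiv 𝓘(ℂ, E) 𝓘(ℂ, E') f x
  rw [(hasMFDerivAt_restrictScalars (T := T) hf.hasMFDerivAt).mfderiv]
  exact T.map_smul Complex.I X

theorem mvfderiv_tangentI {f : M → ℂ} {x : M} (hf : MDifferentiableAt 𝓘(ℂ, E) 𝓘(ℂ, ℂ) f x)
    (X : TangentSpace 𝓘(ℝ, E) x) :
    mvfderiv 𝓘(ℝ, E) f x (tangentI X) = Complex.I * mvfderiv 𝓘(ℝ, E) f x X :=
  mfderiv_tangentI hf X

theorem mvfderiv_comp_of_holomorphic {f : N → ℂ} {p : M → N} {x : M}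
    (hf : MDifferentiableAt 𝓘(ℝ, E') 𝓘(ℝ, ℂ) f (p x))
    (hp : MDifferentiableAt 𝓘(ℂ, E) 𝓘(ℂ, E') p x) (X : TangentSpace 𝓘(ℝ, E) x) :
    mvfderiv 𝓘(ℝ, E) (fun y ↦ f (p y)) x X =
      mvfderiv 𝓘(ℝ, E') f (p x) (mfderiv 𝓘(ℝ, E) 𝓘(ℝ, E') p x X) :=
  congrArg (fun T : E →L[ℝ] ℂ ↦ T X)
    (hf.hasMFDerivAt.comp x (mdifferentiableAt_restrictScalars hp).hasMFDerivAt).mfderiv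

theorem mvfderiv_congr {f g : M → ℂ} {x : M} (h : f =ᶠ[𝓝 x] g) :
    mvfderiv 𝓘(ℝ, E) f x = mvfderiv 𝓘(ℝ, E) g x :=
  ContinuousLinearMap.ext fun X ↦ congrArg (fun T : E →L[ℝ] ℂ ↦ T X) h.mfderiv_eq

theorem mvfderiv_mul_complex {f g : M → ℂ} {x : M} (hf : MDifferentiableAt 𝓘(ℝ, E) 𝓘(ℝ, ℂ) f x)
    (hg : MDifferentiableAt 𝓘(ℝ, E) 𝓘(ℝ, ℂ) g x) :
    mvfderiv 𝓘(ℝ, E) (fun y ↦ f y * g y) x =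
      f x • mvfderiv 𝓘(ℝ, E) g x + g x • mvfderiv 𝓘(ℝ, E) f x := by
  ext X
  have h := congrArg (fun T : E →L[ℝ] ℂ ↦ T X) (hf.hasMFDerivAt.mul' hg.hasMFDerivAt).mfderiv
  exact h.trans (congrArg (f x * mvfderiv 𝓘(ℝ, E) g x X + ·) (mul_comm _ _))

section PostComposition

variable {F F' : Type*} [NormedAddCommGroup F] [NormedSpace ℝ F] [NormedAddCommGroup F']
  [NormedSpace ℝ F'] (A : F →L[ℝ] F') {f : M → F} {x : M}

theorem mdifferentiableAt_clm_comp (hf : MDifferentiableAt 𝓘(ℝ, E) 𝓘(ℝ, F) f x) :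
    MDifferentiableAt 𝓘(ℝ, E) 𝓘(ℝ, F') (fun y ↦ A (f y)) x :=
  A.mdifferentiableAt.comp x hf

theorem mvfderiv_clm_comp (hf : MDifferentiableAt 𝓘(ℝ, E) 𝓘(ℝ, F) f x)
    (X : TangentSpace 𝓘(ℝ, E) x) :
    mvfderiv 𝓘(ℝ, E) (fun y ↦ A (f y)) x X = A (mvfderiv 𝓘(ℝ, E) f x X) :=
  congrArg (fun T : E →L[ℝ] F' ↦ T X) (A.hasMFDerivAt.comp x hf.hasMFDerivAt).mfderiv

end PostComposition

theorem mdifferentiableAt_conj {f : M → ℂ} {x : M} (hf : MDifferentiableAt 𝓘(ℝ, E) 𝓘(ℝ, ℂ) f x) :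
    MDifferentiableAt 𝓘(ℝ, E) 𝓘(ℝ, ℂ) (fun y ↦ starRingEnd ℂ (f y)) x :=
  mdifferentiableAt_clm_comp Complex.conjCLE.toContinuousLinearMap hf

theorem mvfderiv_conj {f : M → ℂ} {x : M} (hf : MDifferentiableAt 𝓘(ℝ, E) 𝓘(ℝ, ℂ) f x)
    (X : TangentSpace 𝓘(ℝ, E) x) :
    mvfderiv 𝓘(ℝ, E) (fun y ↦ starRingEnd ℂ (f y)) x X = starRingEnd ℂ (mvfderiv 𝓘(ℝ, E) f x X) :=
  mvfderiv_clm_comp Complex.conjCLE.toContinuousLinearMap hf X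

/-- The complex-linear part `X ↦ (T X - i T (i X)) / 2` of a real-linear form `T`. -/
def complexLinearPart : (E →L[ℝ] ℂ) →L[ℝ] (E →L[ℝ] ℂ) :=
  (2 : ℂ)⁻¹ • (ContinuousLinearMap.id ℝ _ - Complex.I •
    (ContinuousLinearMap.compL ℝ E E ℂ).flip (Complex.I • ContinuousLinearMap.id ℝ E))

theorem complexLinearPart_apply (T : E →L[ℝ] ℂ) (X : E) :
    complexLinearPart T X = (T X - Complex.I * T (Complex.I • X)) / 2 := by
  rw [div_eq_inv_mul]
  rfl

/-- The `(1,0)`-part `∂f` of the differential of a complex-valued function. -/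
def del (f : M → ℂ) (x : M) : TangentSpace 𝓘(ℝ, E) x →L[ℝ] ℂ :=
  complexLinearPart (E := E) (mvfderiv 𝓘(ℝ, E) f x)

theorem del_apply (f : M → ℂ) (x : M) (X : TangentSpace 𝓘(ℝ, E) x) :
    del f x X =
      (mvfderiv 𝓘(ℝ, E) f x X - Complex.I * mvfderiv 𝓘(ℝ, E) f x (tangentI X)) / 2 :=
  complexLinearPart_apply (E := E) _ X

theorem del_congr {f g : M → ℂ} {x : M} (h : f =ᶠ[𝓝 x] g) : del (E := E) f x = del g x := by
  rw [del, del, mvfderiv_congr h]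

theorem del_tangentI (f : M → ℂ) (x : M) (X : TangentSpace 𝓘(ℝ, E) x) :
    del f x (tangentI X) = Complex.I * del f x X := by
  simp only [del_apply, tangentI_tangentI, map_neg]
  linear_combination mvfderiv 𝓘(ℝ, E) f x (tangentI X) * Complex.I_mul_I / 2

theorem del_mul {f g : M → ℂ} {x : M} (hf : MDifferentiableAt 𝓘(ℝ, E) 𝓘(ℝ, ℂ) f x)
    (hg : MDifferentiableAt 𝓘(ℝ, E) 𝓘(ℝ, ℂ) g x) :
    del (E := E) (fun y ↦ f y * g y) x = f x • del g x + g x • del f x := by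
  ext X
  simp only [del_apply, mvfderiv_mul_complex hf hg, add_apply, FunLike.coe_smul, Pi.smul_apply,
    smul_eq_mul]
  ring

theorem del_of_holomorphic {f : M → ℂ} {x : M} (hf : MDifferentiableAt 𝓘(ℂ, E) 𝓘(ℂ, ℂ) f x) :
    del f x = mvfderiv 𝓘(ℝ, E) f x := by
  ext X
  rw [del_apply, mvfderiv_tangentI hf]
  linear_combination -mvfderiv 𝓘(ℝ, E) f x X * Complex.I_mul_I / 2

theorem del_conj_of_holomorphic {f : M → ℂ} {x : M}
    (hf : MDifferentiableAt 𝓘(ℂ, E) 𝓘(ℂ, ℂ) f x) :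
    del (E := E) (fun y ↦ starRingEnd ℂ (f y)) x = 0 := by
  have hf' := mdifferentiableAt_restrictScalars hf
  ext X
  rw [del_apply, mvfderiv_conj hf', mvfderiv_conj hf', mvfderiv_tangentI hf, map_mul,
    Complex.conj_I, zero_apply]
  linear_combination starRingEnd ℂ (mvfderiv 𝓘(ℝ, E) f x X) * Complex.I_mul_I / 2

theorem del_comp {f : N → ℂ} {p : M → N} {x : M}
    (hf : MDifferentiableAt 𝓘(ℝ, E') 𝓘(ℝ, ℂ) f (p x))
    (hp : MDifferentiableAt 𝓘(ℂ, E) 𝓘(ℂ, E') p x) (X : TangentSpace 𝓘(ℝ, E) x) :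
    del (fun y ↦ f (p y)) x X = del f (p x) (mfderiv 𝓘(ℝ, E) 𝓘(ℝ, E') p x X) := by
  rw [del_apply, del_apply, mvfderiv_comp_of_holomorphic hf hp, mvfderiv_comp_of_holomorphic hf hp,
    mfderiv_tangentI hp]

theorem mvfderiv_eq_del_add_conj {H : M → ℂ} {x : M}
    (hH : MDifferentiableAt 𝓘(ℝ, E) 𝓘(ℝ, ℂ) H x) (hreal : ∀ y, starRingEnd ℂ (H y) = H y)
    (X : TangentSpace 𝓘(ℝ, E) x) :
    mvfderiv 𝓘(ℝ, E) H x X = del H x X + starRingEnd ℂ (del H x X) := by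
  have hconj (Y : TangentSpace 𝓘(ℝ, E) x) :
      starRingEnd ℂ (mvfderiv 𝓘(ℝ, E) H x Y) = mvfderiv 𝓘(ℝ, E) H x Y := by
    rw [← mvfderiv_conj hH]
    simp only [hreal]
  simp only [del_apply, map_div₀, map_sub, map_mul, hconj, Complex.conj_I, map_ofNat]
  ring

/-- The `(1,0)`-form `∂ log H = ∂H / H`: the connection form of the Chern connection in a
holomorphic frame of square length `H`. It is zero where `H` is. -/
def delLog (H : M → ℂ) (x : M) : TangentSpace 𝓘(ℝ, E) x →L[ℝ] ℂ := (H x)⁻¹ • del H x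

theorem delLog_congr {H K : M → ℂ} {x : M} (h : H =ᶠ[𝓝 x] K) :
    delLog (E := E) H x = delLog K x := by
  rw [delLog, delLog, del_congr h, h.eq_of_nhds]

theorem delLog_tangentI (H : M → ℂ) (x : M) (X : TangentSpace 𝓘(ℝ, E) x) :
    delLog H x (tangentI X) = Complex.I * delLog H x X := by
  simp only [delLog, FunLike.coe_smul, Pi.smul_apply, smul_eq_mul, del_tangentI]
  ring

theorem delLog_mul {H K : M → ℂ} {x : M} (hH : MDifferentiableAt 𝓘(ℝ, E) 𝓘(ℝ, ℂ) H x)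
    (hK : MDifferentiableAt 𝓘(ℝ, E) 𝓘(ℝ, ℂ) K x) (hH0 : H x ≠ 0) (hK0 : K x ≠ 0) :
    delLog (E := E) (fun y ↦ H y * K y) x = delLog H x + delLog K x := by
  ext X
  simp only [delLog, del_mul hH hK, add_apply, FunLike.coe_smul, Pi.smul_apply, smul_eq_mul]
  field_simp
  ring

theorem delLog_conj_mul_self {k : M → ℂ} {x : M} (hk : MDifferentiableAt 𝓘(ℂ, E) 𝓘(ℂ, ℂ) k x)
    (hk0 : k x ≠ 0) :
    delLog (E := E) (fun y ↦ starRingEnd ℂ (k y) * k y) x =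
      (k x)⁻¹ • mvfderiv 𝓘(ℝ, E) k x := by
  have hk' := mdifferentiableAt_restrictScalars hk
  have hc : starRingEnd ℂ (k x) ≠ 0 := by simpa using hk0
  ext X
  simp only [delLog, del_mul (mdifferentiableAt_conj hk') hk', del_conj_of_holomorphic hk,
    del_of_holomorphic hk, add_apply, FunLike.coe_smul, Pi.smul_apply, smul_eq_mul, zero_apply]
  field_simp
  ring

theorem delLog_comp {H : N → ℂ} {p : M → N} {x : M}
    (hH : MDifferentiableAt 𝓘(ℝ, E') 𝓘(ℝ, ℂ) H (p x))
    (hp : MDifferentiableAt 𝓘(ℂ, E) 𝓘(ℂ, E') p x) (X : TangentSpace 𝓘(ℝ, E) x) :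
    delLog (fun y ↦ H (p y)) x X = delLog H (p x) (mfderiv 𝓘(ℝ, E) 𝓘(ℝ, E') p x X) :=
  congrArg ((H (p x))⁻¹ * ·) (del_comp hH hp X)

theorem mvfderiv_eq_delLog_add_conj {H : M → ℂ} {x : M}
    (hH : MDifferentiableAt 𝓘(ℝ, E) 𝓘(ℝ, ℂ) H x) (hreal : ∀ y, starRingEnd ℂ (H y) = H y)
    (hH0 : H x ≠ 0) (X : TangentSpace 𝓘(ℝ, E) x) :
    mvfderiv 𝓘(ℝ, E) H x X = (delLog H x X + starRingEnd ℂ (delLog H x X)) * H x := by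
  rw [mvfderiv_eq_del_add_conj hH hreal]
  simp only [delLog, FunLike.coe_smul, Pi.smul_apply, smul_eq_mul, map_mul, map_inv₀, hreal]
  field_simp

theorem eq_delLog_of_mvfderiv_eq {H : M → ℂ} {x : M} {θ : TangentSpace 𝓘(ℝ, E) x → ℂ}
    (hH0 : H x ≠ 0) (hI : ∀ X, θ (tangentI X) = Complex.I * θ X)
    (hH : ∀ X, mvfderiv 𝓘(ℝ, E) H x X = (θ X + starRingEnd ℂ (θ X)) * H x)
    (X : TangentSpace 𝓘(ℝ, E) x) : θ X = delLog H x X := by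
  simp only [delLog, FunLike.coe_smul, Pi.smul_apply, smul_eq_mul, del_apply, hH, hI, map_mul,
    Complex.conj_I]
  field_simp
  linear_combination (θ X - starRingEnd ℂ (θ X)) * Complex.I_mul_I

end ComplexCalculus

section ChernDerivative

variable {E : Type*} [NormedAddCommGroup E] [NormedSpace ℂ E]
  {E' : Type*} [NormedAddCommGroup E'] [NormedSpace ℂ E']
  {M : Type*} [TopologicalSpace M] [ChartedSpace E M]
  {N : Type*} [TopologicalSpace N] [ChartedSpace E' N]
  {x : M}

/-- The Chern covariant derivative `df + f ∂ log H` of the section with coordinate `f` in a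
holomorphic frame of square length `H`. -/
def chernDeriv (H f : M → ℂ) (x : M) : TangentSpace 𝓘(ℝ, E) x →L[ℝ] ℂ :=
  mvfderiv 𝓘(ℝ, E) f x + f x • delLog H x

theorem chernDeriv_apply (H f : M → ℂ) (X : TangentSpace 𝓘(ℝ, E) x) :
    chernDeriv H f x X = mvfderiv 𝓘(ℝ, E) f x X + f x * delLog H x X := rfl

theorem chernDeriv_add (H : M → ℂ) {f g : M → ℂ} (hf : MDifferentiableAt 𝓘(ℝ, E) 𝓘(ℝ, ℂ) f x)
    (hg : MDifferentiableAt 𝓘(ℝ, E) 𝓘(ℝ, ℂ) g x) :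
    chernDeriv (E := E) H (fun y ↦ f y + g y) x = chernDeriv H f x + chernDeriv H g x := by
  ext X
  simp only [chernDeriv, mvfderiv_fun_add hf hg, add_apply, FunLike.coe_smul, Pi.smul_apply,
    smul_eq_mul]
  ring

theorem chernDeriv_leibniz (H : M → ℂ) {f g : M → ℂ}
    (hf : MDifferentiableAt 𝓘(ℝ, E) 𝓘(ℝ, ℂ) f x) (hg : MDifferentiableAt 𝓘(ℝ, E) 𝓘(ℝ, ℂ) g x) :
    chernDeriv (E := E) H (fun y ↦ f y * g y) x =
      f x • chernDeriv H g x + g x • mvfderiv 𝓘(ℝ, E) f x := by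
  rw [chernDeriv, chernDeriv, mvfderiv_mul_complex hf hg, smul_add, smul_smul]
  abel

theorem chernDeriv_mul {H K f g : M → ℂ} (hH : MDifferentiableAt 𝓘(ℝ, E) 𝓘(ℝ, ℂ) H x)
    (hK : MDifferentiableAt 𝓘(ℝ, E) 𝓘(ℝ, ℂ) K x) (hH0 : H x ≠ 0) (hK0 : K x ≠ 0)
    (hf : MDifferentiableAt 𝓘(ℝ, E) 𝓘(ℝ, ℂ) f x) (hg : MDifferentiableAt 𝓘(ℝ, E) 𝓘(ℝ, ℂ) g x) :
    chernDeriv (E := E) (fun y ↦ H y * K y) (fun y ↦ f y * g y) x =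
      g x • chernDeriv H f x + f x • chernDeriv K g x := by
  ext X
  simp only [chernDeriv, mvfderiv_mul_complex hf hg, delLog_mul hH hK hH0 hK0, add_apply,
    FunLike.coe_smul, Pi.smul_apply, smul_eq_mul]
  ring

theorem chernDeriv_comp {H f : N → ℂ} {p : M → N}
    (hH : MDifferentiableAt 𝓘(ℝ, E') 𝓘(ℝ, ℂ) H (p x))
    (hf : MDifferentiableAt 𝓘(ℝ, E') 𝓘(ℝ, ℂ) f (p x))
    (hp : MDifferentiableAt 𝓘(ℂ, E) 𝓘(ℂ, E') p x) (X : TangentSpace 𝓘(ℝ, E) x) :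
    chernDeriv (fun y ↦ H (p y)) (fun y ↦ f (p y)) x X =
      chernDeriv H f (p x) (mfderiv 𝓘(ℝ, E) 𝓘(ℝ, E') p x X) := by
  rw [chernDeriv_apply, chernDeriv_apply, mvfderiv_comp_of_holomorphic hf hp, delLog_comp hH hp]

theorem chernDeriv_tangentI (H : M → ℂ) {f : M → ℂ}
    (hf : MDifferentiableAt 𝓘(ℂ, E) 𝓘(ℂ, ℂ) f x) (X : TangentSpace 𝓘(ℝ, E) x) :
    chernDeriv H f x (tangentI X) = Complex.I * chernDeriv H f x X := by
  rw [chernDeriv_apply, chernDeriv_apply, mvfderiv_tangentI hf, delLog_tangentI]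
  ring

theorem mvfderiv_conj_mul_mul {H f g : M → ℂ} (hH : MDifferentiableAt 𝓘(ℝ, E) 𝓘(ℝ, ℂ) H x)
    (hreal : ∀ y, starRingEnd ℂ (H y) = H y) (hH0 : H x ≠ 0)
    (hf : MDifferentiableAt 𝓘(ℝ, E) 𝓘(ℝ, ℂ) f x) (hg : MDifferentiableAt 𝓘(ℝ, E) 𝓘(ℝ, ℂ) g x)
    (X : TangentSpace 𝓘(ℝ, E) x) :
    mvfderiv 𝓘(ℝ, E) (fun y ↦ starRingEnd ℂ (f y) * (g y * H y)) x X =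
      starRingEnd ℂ (chernDeriv H f x X) * (g x * H x) +
        starRingEnd ℂ (f x) * (chernDeriv H g x X * H x) := by
  have hgH : MDifferentiableAt 𝓘(ℝ, E) 𝓘(ℝ, ℂ) (fun y ↦ g y * H y) x := hg.mul hH
  rw [mvfderiv_mul_complex (mdifferentiableAt_conj hf) hgH, mvfderiv_mul_complex hg hH]
  simp only [add_apply, FunLike.coe_smul, Pi.smul_apply, smul_eq_mul, mvfderiv_conj hf,
    mvfderiv_eq_delLog_add_conj hH hreal hH0, chernDeriv_apply, map_add, map_mul]
  ring

theorem smul_chernDeriv_eq_chernDeriv_mul {H K k f : M → ℂ}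
    (hk : MDifferentiableAt 𝓘(ℂ, E) 𝓘(ℂ, ℂ) k x) (hk0 : k x ≠ 0)
    (hK : MDifferentiableAt 𝓘(ℝ, E) 𝓘(ℝ, ℂ) K x) (hK0 : K x ≠ 0)
    (hf : MDifferentiableAt 𝓘(ℝ, E) 𝓘(ℝ, ℂ) f x)
    (hH : ∀ᶠ y in 𝓝 x, H y = starRingEnd ℂ (k y) * k y * K y) :
    k x • chernDeriv (E := E) H f x = chernDeriv K (fun y ↦ k y * f y) x := by
  have hk' := mdifferentiableAt_restrictScalars hk
  have hkk : MDifferentiableAt 𝓘(ℝ, E) 𝓘(ℝ, ℂ) (fun y ↦ starRingEnd ℂ (k y) * k y) x :=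
    (mdifferentiableAt_conj hk').mul hk'
  have hkk0 : starRingEnd ℂ (k x) * k x ≠ 0 := by simpa using hk0
  ext X
  simp only [chernDeriv, delLog_congr hH, delLog_mul hkk hK hkk0 hK0, delLog_conj_mul_self hk hk0,
    mvfderiv_mul_complex hk' hf, add_apply, FunLike.coe_smul, Pi.smul_apply, smul_eq_mul]
  field_simp
  ring

theorem chernDeriv_smul_eq_of_smul_eq {W : M → Type*} [∀ y, AddCommGroup (W y)]
    [∀ y, Module ℂ (W y)] {σ τ : ∀ y, W y} {H K k f g : M → ℂ}
    (hk : MDifferentiableAt 𝓘(ℂ, E) 𝓘(ℂ, ℂ) k x)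
    (hK : MDifferentiableAt 𝓘(ℝ, E) 𝓘(ℝ, ℂ) K x) (hK0 : K x ≠ 0)
    (hf : MDifferentiableAt 𝓘(ℝ, E) 𝓘(ℝ, ℂ) f x)
    (hσ : ∀ᶠ y in 𝓝 x, σ y = k y • τ y) (hσ0 : ∀ᶠ y in 𝓝 x, σ y ≠ 0)
    (hH : ∀ᶠ y in 𝓝 x, H y = starRingEnd ℂ (k y) * k y * K y)
    (hfg : ∀ᶠ y in 𝓝 x, f y • σ y = g y • τ y) (X : TangentSpace 𝓘(ℝ, E) x) :
    chernDeriv H f x X • σ x = chernDeriv K g x X • τ x := by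
  have hkτ : ∀ᶠ y in 𝓝 x, k y ≠ 0 ∧ τ y ≠ 0 := by
    filter_upwards [hσ, hσ0] with y h h0 using smul_ne_zero_iff.1 (h ▸ h0)
  have hg : g =ᶠ[𝓝 x] fun y ↦ k y * f y := by
    filter_upwards [hσ, hkτ, hfg] with y h h0 hy
    rw [h, smul_smul] at hy
    rw [mul_comm, smul_left_injective ℂ h0.2 hy]
  have hgauge := smul_chernDeriv_eq_chernDeriv_mul hk hkτ.self_of_nhds.1 hK hK0 hf hH
  have hcongr : chernDeriv (E := E) K g x = k x • chernDeriv H f x := by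
    rw [hgauge, chernDeriv, chernDeriv, mvfderiv_congr hg, hg.eq_of_nhds]
  rw [hσ.self_of_nhds, hcongr, FunLike.coe_smul, Pi.smul_apply, smul_smul, smul_eq_mul, mul_comm]

end ChernDerivative

section Charts

variable {E : Type*} [NormedAddCommGroup E] [NormedSpace ℂ E]
  {M : Type*} [TopologicalSpace M] [ChartedSpace E M] [IsManifold 𝓘(ℂ, E) ω M]

/-- The identification of the model space with the tangent space at `y` given by the preferred chart
at `x₀`; it expresses families of forms on the tangent spaces near `x₀` as maps to a
fixed space. -/
def chartDeriv (x₀ y : M) : E →L[ℝ] TangentSpace 𝓘(ℝ, E) y :=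
  (trivializationAt E (TangentSpace 𝓘(ℝ, E)) x₀).symmL ℝ y

theorem chartDeriv_smul_I {x₀ y : M} (hy : y ∈ (chartAt E x₀).source) (X : E) :
    chartDeriv x₀ y (Complex.I • X) = tangentI (chartDeriv x₀ y X) := by
  have hchart : MDifferentiableAt 𝓘(ℂ, E) 𝓘(ℂ, E) (extChartAt 𝓘(ℂ, E) x₀).symm
      (extChartAt 𝓘(ℂ, E) x₀ y) := by
    have : IsManifold 𝓘(ℂ, E) 1 M := .of_le (n := ω) le_top
    have h := mdifferentiableWithinAt_extChartAt_symm (I := 𝓘(ℂ, E)) (x := x₀)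
      ((extChartAt 𝓘(ℂ, E) x₀).map_source (by simpa using hy))
    rwa [modelWithCornersSelf_coe, Set.range_id, mdifferentiableWithinAt_univ] at h
  have hderiv := TangentBundle.symmL_trivializationAt (I := 𝓘(ℝ, E)) hy
  rw [modelWithCornersSelf_coe, Set.range_id, mfderivWithin_univ] at hderiv
  have happly (Y : E) : (chartDeriv x₀ y Y : E) =
      mfderiv 𝓘(ℝ, E) 𝓘(ℝ, E) (extChartAt 𝓘(ℝ, E) x₀).symm (extChartAt 𝓘(ℝ, E) x₀ y) Y :=
    congrArg (fun T : E →L[ℝ] E ↦ T Y) hderiv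
  refine (happly _).trans ((mfderiv_tangentI hchart X).trans ?_)
  exact congrArg (fun Z : E ↦ Complex.I • Z) (happly X).symm

theorem contMDiffAt_mvfderiv_comp_chartDeriv {f : M → ℂ} {x₀ : M}
    (hf : ContMDiffAt 𝓘(ℝ, E) 𝓘(ℝ, ℂ) ∞ f x₀) :
    ContMDiffAt 𝓘(ℝ, E) 𝓘(ℝ, E →L[ℝ] ℂ) ∞
      (fun y ↦ mvfderiv 𝓘(ℝ, E) f y ∘L chartDeriv x₀ y) x₀ := by
  refine (hf.mfderiv_const (m := ∞) (by simp)).congr_of_eventuallyEq ?_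
  filter_upwards [chart_source_mem_nhds E x₀] with y hy
  rw [inTangentCoordinates_eq_mfderiv_comp (by exact hy) (Set.mem_univ (f y))]
  have hT := TangentBundle.symmL_trivializationAt (I := 𝓘(ℝ, E)) hy
  have hid : mfderiv 𝓘(ℝ, ℂ) 𝓘(ℝ, ℂ) (extChartAt 𝓘(ℝ, ℂ) (f x₀)) (f y) =
      ContinuousLinearMap.id ℝ _ := by
    rw [extChartAt_model_space_eq_id]
    exact mfderiv_id
  let D : E →L[ℝ] ℂ := mfderiv 𝓘(ℝ, E) 𝓘(ℝ, ℂ) f y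
  ext X
  exact (congrArg (fun T : E →L[ℝ] E ↦ D (T X)) hT).trans
    (congrArg (fun S : ℂ →L[ℝ] ℂ ↦ S (D (mfderivWithin 𝓘(ℝ, E) 𝓘(ℝ, E)
      (extChartAt 𝓘(ℝ, E) x₀).symm (Set.range 𝓘(ℝ, E)) (extChartAt 𝓘(ℝ, E) x₀ y) X))) hid).symm

theorem del_comp_chartDeriv (f : M → ℂ) {x₀ y : M} (hy : y ∈ (chartAt E x₀).source) :
    del (E := E) f y ∘L chartDeriv x₀ y =
      complexLinearPart (mvfderiv 𝓘(ℝ, E) f y ∘L chartDeriv x₀ y) := by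
  ext X
  rw [complexLinearPart_apply, ContinuousLinearMap.comp_apply, ContinuousLinearMap.comp_apply]
  refine (del_apply f y _).trans ?_
  rw [← chartDeriv_smul_I hy]
  rfl

theorem contMDiffAt_del_comp_chartDeriv {f : M → ℂ} {x₀ : M}
    (hf : ContMDiffAt 𝓘(ℝ, E) 𝓘(ℝ, ℂ) ∞ f x₀) :
    ContMDiffAt 𝓘(ℝ, E) 𝓘(ℝ, E →L[ℝ] ℂ) ∞ (fun y ↦ del (E := E) f y ∘L chartDeriv x₀ y) x₀ := by
  have hcomp := (complexLinearPart (E := E)).contMDiff.contMDiffAt.comp x₀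
    (contMDiffAt_mvfderiv_comp_chartDeriv hf)
  refine hcomp.congr_of_eventuallyEq ?_
  filter_upwards [chart_source_mem_nhds E x₀] with y hy using del_comp_chartDeriv f hy

theorem contMDiffAt_chernDeriv_comp_chartDeriv {H f : M → ℂ} {x₀ : M}
    (hH : ContMDiffAt 𝓘(ℝ, E) 𝓘(ℝ, ℂ) ∞ H x₀) (hH0 : H x₀ ≠ 0)
    (hf : ContMDiffAt 𝓘(ℝ, E) 𝓘(ℝ, ℂ) ∞ f x₀) :
    ContMDiffAt 𝓘(ℝ, E) 𝓘(ℝ, E →L[ℝ] ℂ) ∞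
      (fun y ↦ chernDeriv (E := E) H f y ∘L chartDeriv x₀ y) x₀ := by
  have hquot : ContMDiffAt 𝓘(ℝ, E) 𝓘(ℝ, ℂ) ∞ (fun y ↦ f y * (H y)⁻¹) x₀ :=
    (contDiffAt_fst.mul (contDiffAt_snd.inv hH0) :
      ContDiffAt ℝ ∞ (fun z : ℂ × ℂ ↦ z.1 * z.2⁻¹) (f x₀, H x₀)).contMDiffAt.comp x₀
        (hf.prodMk_space hH)
  have hform := (contDiff_fst.smul contDiff_snd : ContDiff ℝ ∞ fun z : ℂ × (E →L[ℝ] ℂ) ↦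
    z.1 • z.2).contMDiff.contMDiffAt.comp x₀
      (hquot.prodMk_space (contMDiffAt_del_comp_chartDeriv hH))
  refine ((contMDiffAt_mvfderiv_comp_chartDeriv hf).add hform).congr_of_eventuallyEq (.of_forall ?_)
  exact fun y ↦ ContinuousLinearMap.ext fun X ↦ congrArg (mvfderiv 𝓘(ℝ, E) f y _ + ·)
    (mul_assoc (f y) (H y)⁻¹ (del H y (chartDeriv x₀ y X))).symm

end Charts

namespace HolLineBundle

variable {E : Type*} [NormedAddCommGroup E] [NormedSpace ℂ E]
  {M : Type*} [TopologicalSpace M] [ChartedSpace E M] (L : HolLineBundle E M)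

instance contMDiffVectorBundleReal : ContMDiffVectorBundle ∞ ℂ L.Fiber 𝓘(ℝ, E) where
  contMDiffOn_coordChangeL e e' he he' x hx := by
    have hhol := contMDiffWithinAt_restrictScalars
      (ContMDiffVectorBundle.contMDiffOn_coordChangeL (n := ω) (IB := 𝓘(ℂ, E)) (𝕜 := ℂ)
        (F := ℂ) (E := L.Fiber) e e' x hx)
    have hreal := (ContinuousLinearMap.restrictScalarsL ℂ ℂ ℂ ℝ ℝ).contMDiff.contMDiffAt
      |>.comp_contMDiffWithinAt x hhol
    refine hreal.congr_of_mem (fun b hb ↦ ?_) hx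
    ext1
    simp [Trivialization.coordChangeL_apply _ _ hb]

/-- The domain of the preferred trivialisation at `x₀`. -/
def frameSet (x₀ : M) : Set M := (trivializationAt ℂ L.Fiber x₀).baseSet

/-- The holomorphic frame near `x₀` given by the preferred trivialisation. -/
def frame (x₀ y : M) : L.Fiber y := (trivializationAt ℂ L.Fiber x₀).symm y 1

/-- The coordinate with respect to the frame near `x₀`; it is zero off the domain of the frame. -/
def coord (x₀ y : M) : L.Fiber y →ₗ[ℂ] ℂ := (trivializationAt ℂ L.Fiber x₀).linearMapAt ℂ y

theorem mem_frameSet (x₀ : M) : x₀ ∈ L.frameSet x₀ := mem_baseSet_trivializationAt _ _ _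

variable {L} {x₀ y : M}

theorem frameSet_mem_nhds (hy : y ∈ L.frameSet x₀) : L.frameSet x₀ ∈ 𝓝 y :=
  (trivializationAt ℂ L.Fiber x₀).open_baseSet.mem_nhds hy

theorem coord_apply (hy : y ∈ L.frameSet x₀) (v : L.Fiber y) :
    L.coord x₀ y v = (trivializationAt ℂ L.Fiber x₀ ⟨y, v⟩).2 :=
  congrFun ((trivializationAt ℂ L.Fiber x₀).coe_linearMapAt_of_mem hy) v

theorem coord_frame (hy : y ∈ L.frameSet x₀) : L.coord x₀ y (L.frame x₀ y) = 1 := by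
  rw [coord_apply hy, frame, Trivialization.apply_mk_symm _ hy]

theorem coord_smul_frame (hy : y ∈ L.frameSet x₀) (v : L.Fiber y) :
    L.coord x₀ y v • L.frame x₀ y = v := by
  have hsmul := ((trivializationAt ℂ L.Fiber x₀).symmₗ ℂ y).map_smul (L.coord x₀ y v) 1
  simp only [Trivialization.symmₗ_apply _ hy, smul_eq_mul, mul_one] at hsmul
  rw [frame, ← hsmul, coord_apply hy]
  exact (trivializationAt ℂ L.Fiber x₀).symm_apply_apply_mk hy v

theorem frame_ne_zero (hy : y ∈ L.frameSet x₀) : L.frame x₀ y ≠ 0 := fun h ↦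
  one_ne_zero (α := ℂ) (by rw [← coord_frame hy, h, map_zero])

section Along

variable {N : Type*} [TopologicalSpace N] [ChartedSpace E N] {p : N → M} {x : N}

theorem holAlong_iff_coord {s : ∀ y, L.Fiber (p y)} (hp : ContMDiffAt 𝓘(ℂ, E) 𝓘(ℂ, E) ω p x)
    (hx : p x ∈ L.frameSet x₀) :
    L.HolAlong p s x ↔ ContMDiffAt 𝓘(ℂ, E) 𝓘(ℂ, ℂ) ω (fun y ↦ L.coord x₀ (p y) (s y)) x := by
  have hcoord : (fun y ↦ L.coord x₀ (p y) (s y)) =ᶠ[𝓝 x]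
      fun y ↦ (trivializationAt ℂ L.Fiber x₀ ⟨p y, s y⟩).2 := by
    filter_upwards [hp.continuousAt (frameSet_mem_nhds hx)] with y hy using coord_apply hy _
  rw [hcoord.contMDiffAt_iff]
  refine (Trivialization.contMDiffAt_iff (n := ω) (IB := 𝓘(ℂ, E)) (IM := 𝓘(ℂ, E))
    (e := trivializationAt ℂ L.Fiber x₀) (f := fun y ↦ TotalSpace.mk' ℂ (p y) (s y)) (x₀ := x)
    ((trivializationAt ℂ L.Fiber x₀).mem_source.2 hx)).trans (and_iff_right hp)

theorem holAlong_frame (hp : ContMDiffAt 𝓘(ℂ, E) 𝓘(ℂ, E) ω p x) (hx : p x ∈ L.frameSet x₀) :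
    L.HolAlong p (fun y ↦ L.frame x₀ (p y)) x := by
  rw [holAlong_iff_coord hp hx]
  refine (contMDiffAt_const (c := (1 : ℂ))).congr_of_eventuallyEq ?_
  filter_upwards [hp.continuousAt (frameSet_mem_nhds hx)] with y hy using coord_frame hy

end Along

theorem HolAt.contMDiffAt_coord {s : ∀ y, L.Fiber y} (hs : L.HolAt s y)
    (hy : y ∈ L.frameSet x₀) :
    ContMDiffAt 𝓘(ℂ, E) 𝓘(ℂ, ℂ) ω (fun z ↦ L.coord x₀ z (s z)) y :=
  (holAlong_iff_coord contMDiffAt_id hy).1 hs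

theorem HolAt.mdifferentiableAt_coord {s : ∀ y, L.Fiber y} (hs : L.HolAt s y)
    (hy : y ∈ L.frameSet x₀) :
    MDifferentiableAt 𝓘(ℂ, E) 𝓘(ℂ, ℂ) (fun z ↦ L.coord x₀ z (s z)) y :=
  (hs.contMDiffAt_coord hy).mdifferentiableAt (by simp)

theorem holAt_frame (hy : y ∈ L.frameSet x₀) : L.HolAt (L.frame x₀) y :=
  holAlong_frame contMDiffAt_id hy

theorem coord_eventuallyEq (hy : y ∈ L.frameSet x₀) (s : ∀ y, L.Fiber y) :
    (fun z ↦ L.coord x₀ z (s z)) =ᶠ[𝓝 y] fun z ↦ (trivializationAt ℂ L.Fiber x₀ ⟨z, s z⟩).2 := by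
  filter_upwards [frameSet_mem_nhds hy] with z hz using coord_apply hz _

theorem diffAt_iff_coord {s : ∀ y, L.Fiber y} (hy : y ∈ L.frameSet x₀) :
    L.DiffAt s y ↔ MDifferentiableAt 𝓘(ℝ, E) 𝓘(ℝ, ℂ) (fun z ↦ L.coord x₀ z (s z)) y := by
  rw [(coord_eventuallyEq hy s).mdifferentiableAt_iff]
  exact Trivialization.mdifferentiableAt_section_iff 𝓘(ℝ, E) (trivializationAt ℂ L.Fiber x₀) s hy

theorem contMDiffAt_iff_coord {s : ∀ y, L.Fiber y} :
    ContMDiffAt 𝓘(ℝ, E) (𝓘(ℝ, E).prod 𝓘(ℝ, ℂ)) ∞ (fun y ↦ TotalSpace.mk' ℂ y (s y)) y ↔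
      ContMDiffAt 𝓘(ℝ, E) 𝓘(ℝ, ℂ) ∞ (fun z ↦ L.coord y z (s z)) y := by
  rw [(coord_eventuallyEq (L.mem_frameSet y) s).contMDiffAt_iff, contMDiffAt_section]

theorem smoothOn_frame : L.SmoothOn (L.frame x₀) (L.frameSet x₀) := by
  refine (Trivialization.contMDiffOn_section_iff (n := ∞) (IB := 𝓘(ℝ, E))
    (trivializationAt ℂ L.Fiber x₀) (trivializationAt ℂ L.Fiber x₀).open_baseSet subset_rfl).2 ?_
  exact (contMDiffOn_const (c := (1 : ℂ))).congr fun y hy ↦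
    (coord_apply hy _).symm.trans (coord_frame hy)

theorem HolAt.diffAt {s : ∀ y, L.Fiber y} (h : L.HolAt s y) : L.DiffAt s y :=
  (diffAt_iff_coord (L.mem_frameSet y)).2
    (mdifferentiableAt_restrictScalars (h.mdifferentiableAt_coord (L.mem_frameSet y)))

theorem diffAt_frame (hy : y ∈ L.frameSet x₀) : L.DiffAt (L.frame x₀) y := (holAt_frame hy).diffAt

theorem DiffAt.add {s t : ∀ y, L.Fiber y} (hs : L.DiffAt s y) (ht : L.DiffAt t y) :
    L.DiffAt (s + t) y :=
  mdifferentiableAt_add_section hs ht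

theorem DiffAt.smul {f : M → ℂ} {s : ∀ y, L.Fiber y} (hs : L.DiffAt s y)
    (hf : MDifferentiableAt 𝓘(ℝ, E) 𝓘(ℝ, ℂ) f y) : L.DiffAt (fun z ↦ f z • s z) y := by
  rw [diffAt_iff_coord (L.mem_frameSet y)] at hs ⊢
  simp only [map_smul]
  exact hf.mul hs

end HolLineBundle

section Chern

variable {E : Type*} [NormedAddCommGroup E] [NormedSpace ℂ E]
  {M : Type*} [TopologicalSpace M] [ChartedSpace E M] {L : HolLineBundle E M}
  {h : HermitianMetric L} {x₀ y : M}

open HolLineBundle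

namespace HermitianMetric

variable (h) in
/-- The square length of the frame near `x₀`. -/
def frameNorm (x₀ y : M) : ℂ := h.form y (L.frame x₀ y) (L.frame x₀ y)

theorem conj_frameNorm (y : M) : starRingEnd ℂ (h.frameNorm x₀ y) = h.frameNorm x₀ y :=
  h.conj_symm _ _ _

theorem frameNorm_ne_zero (hy : y ∈ L.frameSet x₀) : h.frameNorm x₀ y ≠ 0 := fun h0 ↦
  (h.pos y _ (frame_ne_zero hy)).ne' (congrArg Complex.re h0)

theorem contMDiffAt_frameNorm (hy : y ∈ L.frameSet x₀) :
    ContMDiffAt 𝓘(ℝ, E) 𝓘(ℝ, ℂ) ∞ (h.frameNorm x₀) y :=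
  (h.smooth _ (trivializationAt ℂ L.Fiber x₀).open_baseSet _ _ smoothOn_frame
    smoothOn_frame).contMDiffAt (frameSet_mem_nhds hy)

theorem mdifferentiableAt_frameNorm (hy : y ∈ L.frameSet x₀) :
    MDifferentiableAt 𝓘(ℝ, E) 𝓘(ℝ, ℂ) (h.frameNorm x₀) y :=
  (contMDiffAt_frameNorm hy).mdifferentiableAt (by simp)

theorem form_eq_coord (hy : y ∈ L.frameSet x₀) (a b : L.Fiber y) :
    h.form y a b = starRingEnd ℂ (L.coord x₀ y a) * (L.coord x₀ y b * h.frameNorm x₀ y) := by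
  conv_lhs => rw [← coord_smul_frame hy a, ← coord_smul_frame hy b]
  simp only [map_smulₛₗ, LinearMap.smul_apply, smul_eq_mul, RingHom.id_apply, frameNorm]
  ring

end HermitianMetric

open HermitianMetric

variable (h) in
open Classical in
/-- The Chern connection, as a function on all sections, computed at `x` in the frame near `x`; it
is zero on sections that are not differentiable at `x`, as `Connection` demands. -/
def chernFun (s : ∀ y, L.Fiber y) (x : M) : TangentSpace 𝓘(ℝ, E) x →L[ℝ] L.Fiber x :=
  if L.DiffAt s x then
    (chernDeriv (h.frameNorm x) (fun y ↦ L.coord x y (s y)) x).smulRight (L.frame x x)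
  else 0

theorem chernFun_apply {s : ∀ y, L.Fiber y} (hs : L.DiffAt s y) (hy : y ∈ L.frameSet x₀)
    (X : TangentSpace 𝓘(ℝ, E) y) :
    chernFun h s y X =
      chernDeriv (h.frameNorm x₀) (fun z ↦ L.coord x₀ z (s z)) y X • L.frame x₀ y := by
  have hy' := L.mem_frameSet y
  rw [chernFun, if_pos hs]
  refine chernDeriv_smul_eq_of_smul_eq (k := fun z ↦ L.coord x₀ z (L.frame y z))
    ((holAt_frame hy').mdifferentiableAt_coord hy) (mdifferentiableAt_frameNorm hy)
    (frameNorm_ne_zero hy) ((diffAt_iff_coord hy').1 hs) ?_ ?_ ?_ ?_ X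
  all_goals filter_upwards [frameSet_mem_nhds hy, frameSet_mem_nhds hy'] with z hz hz'
  · exact (coord_smul_frame hz _).symm
  · exact frame_ne_zero hz'
  · rw [mul_assoc]
    exact form_eq_coord hz _ _
  · rw [coord_smul_frame hz, coord_smul_frame hz']

theorem coord_chernFun {s : ∀ y, L.Fiber y} (hs : L.DiffAt s y) (hy : y ∈ L.frameSet x₀)
    (X : TangentSpace 𝓘(ℝ, E) y) :
    L.coord x₀ y (chernFun h s y X) =
      chernDeriv (h.frameNorm x₀) (fun z ↦ L.coord x₀ z (s z)) y X := by
  rw [chernFun_apply hs hy, map_smul, coord_frame hy, smul_eq_mul, mul_one]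

theorem chernFun_add {s t : ∀ y, L.Fiber y} (hs : L.DiffAt s y) (ht : L.DiffAt t y) :
    chernFun h (s + t) y = chernFun h s y + chernFun h t y := by
  have hy := L.mem_frameSet y
  ext X
  rw [add_apply, chernFun_apply (hs.add ht) hy, chernFun_apply hs hy, chernFun_apply ht hy,
    ← add_smul]
  simp only [Pi.add_apply, map_add]
  rw [chernDeriv_add _ ((diffAt_iff_coord hy).1 hs) ((diffAt_iff_coord hy).1 ht), add_apply]

theorem chernFun_smul {f : M → ℂ} {s : ∀ y, L.Fiber y} (hs : L.DiffAt s y)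
    (hf : MDifferentiableAt 𝓘(ℝ, E) 𝓘(ℝ, ℂ) f y) (X : TangentSpace 𝓘(ℝ, E) y) :
    chernFun h (fun z ↦ f z • s z) y X =
      f y • chernFun h s y X + mvfderiv 𝓘(ℝ, E) f y X • s y := by
  have hy := L.mem_frameSet y
  rw [chernFun_apply (hs.smul hf) hy, chernFun_apply hs hy]
  simp only [map_smul, smul_eq_mul]
  rw [chernDeriv_leibniz _ hf ((diffAt_iff_coord hy).1 hs), add_apply, FunLike.coe_smul,
    FunLike.coe_smul, Pi.smul_apply, Pi.smul_apply, smul_eq_mul, smul_eq_mul, add_smul, mul_smul,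
    mul_comm, mul_smul, coord_smul_frame hy]

theorem mvfderiv_form {s t : ∀ y, L.Fiber y} (hs : L.DiffAt s y) (ht : L.DiffAt t y)
    (X : TangentSpace 𝓘(ℝ, E) y) :
    mvfderiv 𝓘(ℝ, E) (fun z ↦ h.form z (s z) (t z)) y X =
      h.form y (chernFun h s y X) (t y) + h.form y (s y) (chernFun h t y X) := by
  have hy := L.mem_frameSet y
  have hform : (fun z ↦ h.form z (s z) (t z)) =ᶠ[𝓝 y] fun z ↦
      starRingEnd ℂ (L.coord y z (s z)) * (L.coord y z (t z) * h.frameNorm y z) := by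
    filter_upwards [frameSet_mem_nhds hy] with z hz using form_eq_coord hz _ _
  rw [mvfderiv_congr hform, mvfderiv_conj_mul_mul (mdifferentiableAt_frameNorm hy) conj_frameNorm
    (frameNorm_ne_zero hy) ((diffAt_iff_coord hy).1 hs) ((diffAt_iff_coord hy).1 ht),
    form_eq_coord hy, form_eq_coord hy, coord_chernFun hs hy, coord_chernFun ht hy]

theorem chernFun_tangentI {s : ∀ y, L.Fiber y} (hs : L.HolAt s y) (X : TangentSpace 𝓘(ℝ, E) y) :
    chernFun h s y (tangentI X) = Complex.I • chernFun h s y X := by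
  have hy := L.mem_frameSet y
  rw [chernFun_apply hs.diffAt hy, chernFun_apply hs.diffAt hy,
    chernDeriv_tangentI _ (hs.mdifferentiableAt_coord hy), mul_smul]

variable [IsManifold 𝓘(ℂ, E) ω M]

theorem inCoordinates_apply_eq_coord (T : TangentSpace 𝓘(ℝ, E) y →L[ℝ] L.Fiber y)
    (hy : y ∈ L.frameSet x₀) (X : E) :
    ContinuousLinearMap.inCoordinates E (TangentSpace 𝓘(ℝ, E)) ℂ L.Fiber x₀ y x₀ y T X =
      L.coord x₀ y (T (chartDeriv x₀ y X)) := by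
  simp only [ContinuousLinearMap.inCoordinates, ContinuousLinearMap.comp_apply,
    Trivialization.continuousLinearMapAt_apply]
  rw [Trivialization.coe_linearMapAt_of_mem _ hy, coord_apply hy]
  rfl

theorem contMDiffCovariantDerivativeOn_chernFun {W : Set M} (hW : IsOpen W) :
    ContMDiffCovariantDerivativeOn ℂ ∞ (chernFun h) W where
  contMDiff {s} hs x₀ hx₀ := by
    have hs' (y : M) (hy : y ∈ W) : ContMDiffAt 𝓘(ℝ, E) (𝓘(ℝ, E).prod 𝓘(ℝ, ℂ)) ∞
        (fun y ↦ TotalSpace.mk' ℂ y (s y)) y := hs.contMDiffAt (hW.mem_nhds hy)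
    have hframe := L.mem_frameSet x₀
    refine ContMDiffAt.contMDiffWithinAt (contMDiffAt_hom_bundle _ |>.2 ⟨contMDiffAt_id, ?_⟩)
    refine (contMDiffAt_chernDeriv_comp_chartDeriv (contMDiffAt_frameNorm (h := h) hframe)
      (frameNorm_ne_zero hframe) (contMDiffAt_iff_coord.1 (hs' x₀ hx₀))).congr_of_eventuallyEq ?_
    filter_upwards [frameSet_mem_nhds hframe, hW.mem_nhds hx₀] with y hy hyW
    have hsy : L.DiffAt s y := (hs' y hyW).mdifferentiableAt (by simp)
    exact ContinuousLinearMap.ext fun X ↦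
      (inCoordinates_apply_eq_coord (chernFun h s y) hy X).trans (coord_chernFun hsy hy _)

variable (h) in
/-- The Chern connection of a hermitian holomorphic line bundle. -/
def chernConnection : Connection L where
  toFun := chernFun h
  isCovariantDerivativeOnUniv :=
    { add := fun hs ht _ ↦ chernFun_add hs ht
      leibniz := fun {s f x} hs hf _ ↦ by
        have hcoe : f • s = fun y ↦ Complex.ofRealCLM (f y) • s y :=
          funext fun y ↦ (Complex.coe_smul (f y) (s y)).symm
        ext X
        rw [hcoe, chernFun_smul hs (mdifferentiableAt_clm_comp Complex.ofRealCLM hf),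
          mvfderiv_clm_comp Complex.ofRealCLM hf, Complex.ofRealCLM_apply, Complex.ofRealCLM_apply,
          Complex.coe_smul, Complex.coe_smul]
        rfl }
  complex_leibniz _ _ _ X hs hf := chernFun_smul hs hf X
  smooth _ hW := contMDiffCovariantDerivativeOn_chernFun hW
  eq_zero_of_not_diffAt _ _ hs := if_neg hs

theorem preservesMetric_chernConnection : (chernConnection h).PreservesMetric h :=
  fun _ _ _ X hs ht ↦ mvfderiv_form hs ht X

theorem isHolCompatible_chernConnection : (chernConnection h).IsHolCompatible :=
  fun _ _ X hs ↦ chernFun_tangentI hs X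

namespace Connection

variable {D : Connection L}

theorem apply_frame (hD : D.PreservesMetric h) (hD' : D.IsHolCompatible) (hy : y ∈ L.frameSet x₀)
    (X : TangentSpace 𝓘(ℝ, E) y) :
    D.toFun (L.frame x₀) y X = delLog (h.frameNorm x₀) y X • L.frame x₀ y := by
  set θ := fun Y ↦ L.coord x₀ y (D.toFun (L.frame x₀) y Y)
  have hθ (Y : TangentSpace 𝓘(ℝ, E) y) : D.toFun (L.frame x₀) y Y = θ Y • L.frame x₀ y :=
    (coord_smul_frame hy _).symm
  have hθI (Y : TangentSpace 𝓘(ℝ, E) y) : θ (tangentI Y) = Complex.I * θ Y := by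
    simp only [θ, hD' _ _ Y (holAt_frame hy), map_smul, smul_eq_mul]
  have hnorm (Y : TangentSpace 𝓘(ℝ, E) y) : mvfderiv 𝓘(ℝ, E) (h.frameNorm x₀) y Y =
      (θ Y + starRingEnd ℂ (θ Y)) * h.frameNorm x₀ y := by
    refine (hD _ _ _ Y (diffAt_frame hy) (diffAt_frame hy)).trans ?_
    rw [hθ, form_eq_coord hy, form_eq_coord hy, map_smul, coord_frame hy, smul_eq_mul, mul_one,
      map_one]
    ring
  rw [hθ, eq_delLog_of_mvfderiv_eq (frameNorm_ne_zero hy) hθI hnorm]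

theorem eq_chernConnection (hD : D.PreservesMetric h) (hD' : D.IsHolCompatible) :
    D = chernConnection h := by
  ext s x X
  by_cases hs : L.DiffAt s x
  · have hx := L.mem_frameSet x
    have hcoord := (diffAt_iff_coord hx).1 hs
    have hlocal : D.toFun s x = D.toFun (fun z ↦ L.coord x z (s z) • L.frame x z) x := by
      refine D.isCovariantDerivativeOnUniv.congr_of_eventuallyEq hs
        ((diffAt_frame hx).smul hcoord) univ_mem ?_
      filter_upwards [frameSet_mem_nhds hx] with z hz using (coord_smul_frame hz _).symm
    refine Eq.trans ?_ (chernFun_apply hs hx X).symm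
    rw [hlocal, D.complex_leibniz _ _ _ _ (diffAt_frame hx) hcoord, apply_frame hD hD' hx,
      chernDeriv_apply, smul_smul, ← add_smul, add_comm]
  · rw [D.eq_zero_of_not_diffAt s x hs, (chernConnection h).eq_zero_of_not_diffAt s x hs]

end Connection

end Chern

section Parallel

variable {E : Type*} [NormedAddCommGroup E] [NormedSpace ℂ E]
  {N : Type*} [TopologicalSpace N] [ChartedSpace E N]
  {M₁ : Type*} [TopologicalSpace M₁] [ChartedSpace E M₁]
  {M₂ : Type*} [TopologicalSpace M₂] [ChartedSpace E M₂]
  {M₃ : Type*} [TopologicalSpace M₃] [ChartedSpace E M₃]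
  {M₄ : Type*} [TopologicalSpace M₄] [ChartedSpace E M₄]
  {A : HolLineBundle E M₁} {B : HolLineBundle E M₂} {C : HolLineBundle E M₃}
  {D : HolLineBundle E M₄}
  {hA : HermitianMetric A} {hB : HermitianMetric B} {hC : HermitianMetric C}
  {hD : HermitianMetric D}
  {p : N → M₁} {q : N → M₂} {r : N → M₃} {t : N → M₄} {x : N} {u : M₁} {v : M₂} {w : M₃}

open HolLineBundle HermitianMetric

theorem tensorForm_smul_tmul_self {V W : Type*} [AddCommGroup V] [Module ℂ V] [AddCommGroup W]
    [Module ℂ W] (h : V →ₗ⋆[ℂ] V →ₗ[ℂ] ℂ) (k : W →ₗ⋆[ℂ] W →ₗ[ℂ] ℂ) (z : ℂ) (v : V) (w : W) :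
    tensorForm h k (z • (v ⊗ₜ[ℂ] w)) (z • (v ⊗ₜ[ℂ] w)) =
      starRingEnd ℂ z * z * (h v v * k w w) := by
  rw [TensorProduct.smul_tmul', tensorForm_tmul]
  simp only [map_smulₛₗ, LinearMap.smul_apply, smul_eq_mul, RingHom.id_apply]
  ring

theorem coord_mul_coord_smul_frame_tmul_frame {y : M₂} {z : M₃} (hy : y ∈ B.frameSet v)
    (hz : z ∈ C.frameSet w) (b : B.Fiber y) (c : C.Fiber z) :
    (B.coord v y b * C.coord w z c) • (B.frame v y ⊗ₜ[ℂ] C.frame w z) = b ⊗ₜ[ℂ] c := by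
  rw [← TensorProduct.smul_tmul_smul, coord_smul_frame hy, coord_smul_frame hz]

theorem frame_tmul_frame_ne_zero {y : M₂} {z : M₃} (hy : y ∈ B.frameSet v)
    (hz : z ∈ C.frameSet w) : B.frame v y ⊗ₜ[ℂ] C.frame w z ≠ 0 := fun h ↦ by
  have hone := congrArg (LinearMap.mul' ℂ ℂ ∘ₗ TensorProduct.map (B.coord v y) (C.coord w z)) h
  simp [coord_frame hy, coord_frame hz] at hone

theorem exists_tmul_eq_smul_frame_tmul_frame {b : ∀ y, B.Fiber (q y)} {c : ∀ y, C.Fiber (r y)}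
    (hq : ContMDiffAt 𝓘(ℂ, E) 𝓘(ℂ, E) ω q x) (hr : ContMDiffAt 𝓘(ℂ, E) 𝓘(ℂ, E) ω r x)
    (hv : q x ∈ B.frameSet v) (hw : r x ∈ C.frameSet w) (hb : B.HolAlong q b x)
    (hc : C.HolAlong r c x) :
    ∃ k : N → ℂ, MDifferentiableAt 𝓘(ℂ, E) 𝓘(ℂ, ℂ) k x ∧
      ∀ᶠ y in 𝓝 x, b y ⊗ₜ[ℂ] c y = k y • (B.frame v (q y) ⊗ₜ[ℂ] C.frame w (r y)) := by
  rw [holAlong_iff_coord hq hv] at hb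
  rw [holAlong_iff_coord hr hw] at hc
  refine ⟨fun y ↦ B.coord v (q y) (b y) * C.coord w (r y) (c y),
    (hb.mdifferentiableAt (by simp)).mul (hc.mdifferentiableAt (by simp)), ?_⟩
  filter_upwards [hq.continuousAt (frameSet_mem_nhds hv), hr.continuousAt (frameSet_mem_nhds hw)]
    with y hy hy' using (coord_mul_coord_smul_frame_tmul_frame hy hy' _ _).symm

section Pullback

variable {a : ∀ y, A.Fiber y} (hp : MDifferentiableAt 𝓘(ℂ, E) 𝓘(ℂ, E) p x)
  (hu : p x ∈ A.frameSet u)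
include hp hu

theorem mdifferentiableAt_coord_comp (ha : A.DiffAt a (p x)) :
    MDifferentiableAt 𝓘(ℝ, E) 𝓘(ℝ, ℂ) (fun y ↦ A.coord u (p y) (a (p y))) x :=
  ((diffAt_iff_coord hu).1 ha).comp x (mdifferentiableAt_restrictScalars hp)

theorem mdifferentiableAt_frameNorm_comp :
    MDifferentiableAt 𝓘(ℝ, E) 𝓘(ℝ, ℂ) (fun y ↦ hA.frameNorm u (p y)) x :=
  (mdifferentiableAt_frameNorm hu).comp x (mdifferentiableAt_restrictScalars hp)

theorem chernFun_comp_apply (ha : A.DiffAt a (p x)) (X : TangentSpace 𝓘(ℝ, E) x) :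
    chernFun hA a (p x) (mfderiv 𝓘(ℝ, E) 𝓘(ℝ, E) p x X) =
      chernDeriv (fun y ↦ hA.frameNorm u (p y)) (fun y ↦ A.coord u (p y) (a (p y))) x X •
        A.frame u (p x) := by
  rw [chernFun_apply ha hu, chernDeriv_comp (f := fun z ↦ A.coord u z (a z))
    (mdifferentiableAt_frameNorm hu) ((diffAt_iff_coord hu).1 ha) hp]

end Pullback

section TensorProduct

variable {b : ∀ y, B.Fiber y} {c : ∀ y, C.Fiber y}

theorem chernFun_tmul_add_tmul_chernFun (hq : MDifferentiableAt 𝓘(ℂ, E) 𝓘(ℂ, E) q x)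
    (hr : MDifferentiableAt 𝓘(ℂ, E) 𝓘(ℂ, E) r x) (hv : q x ∈ B.frameSet v)
    (hw : r x ∈ C.frameSet w) (hb : B.DiffAt b (q x)) (hc : C.DiffAt c (r x))
    (X : TangentSpace 𝓘(ℝ, E) x) :
    chernFun hB b (q x) (mfderiv 𝓘(ℝ, E) 𝓘(ℝ, E) q x X) ⊗ₜ[ℂ] c (r x) +
        b (q x) ⊗ₜ[ℂ] chernFun hC c (r x) (mfderiv 𝓘(ℝ, E) 𝓘(ℝ, E) r x X) =
      chernDeriv (fun y ↦ hB.frameNorm v (q y) * hC.frameNorm w (r y))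
        (fun y ↦ B.coord v (q y) (b (q y)) * C.coord w (r y) (c (r y))) x X •
          (B.frame v (q x) ⊗ₜ[ℂ] C.frame w (r x)) := by
  rw [chernDeriv_mul (mdifferentiableAt_frameNorm_comp hq hv)
    (mdifferentiableAt_frameNorm_comp hr hw) (frameNorm_ne_zero hv) (frameNorm_ne_zero hw)
    (mdifferentiableAt_coord_comp hq hv hb) (mdifferentiableAt_coord_comp hr hw hc),
    chernFun_comp_apply hq hv hb, chernFun_comp_apply hr hw hc]
  nth_rw 1 [← coord_smul_frame hw (c (r x)), ← coord_smul_frame hv (b (q x))]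
  rw [TensorProduct.smul_tmul_smul, TensorProduct.smul_tmul_smul, ← add_smul, add_apply,
    FunLike.coe_smul, FunLike.coe_smul, Pi.smul_apply, Pi.smul_apply, smul_eq_mul, smul_eq_mul,
    mul_comm (C.coord _ _ _)]

theorem chernDeriv_smul_eq_chernFun_tmul {s : ∀ y, B.Fiber (q y)} {s' : ∀ y, C.Fiber (r y)}
    {σ : ∀ y, B.Fiber (q y) ⊗[ℂ] C.Fiber (r y)} {H f : N → ℂ}
    (hq : ContMDiffAt 𝓘(ℂ, E) 𝓘(ℂ, E) ω q x) (hr : ContMDiffAt 𝓘(ℂ, E) 𝓘(ℂ, E) ω r x)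
    (hb : B.DiffAt b (q x)) (hc : C.DiffAt c (r x)) (hs : B.HolAlong q s x)
    (hs' : C.HolAlong r s' x) (hσ : ∀ᶠ y in 𝓝 x, σ y = s y ⊗ₜ[ℂ] s' y)
    (hσ0 : ∀ᶠ y in 𝓝 x, σ y ≠ 0)
    (hH : ∀ᶠ y in 𝓝 x, H y = tensorForm (hB.form (q y)) (hC.form (r y)) (σ y) (σ y))
    (hf : MDifferentiableAt 𝓘(ℝ, E) 𝓘(ℝ, ℂ) f x)
    (hfσ : ∀ᶠ y in 𝓝 x, f y • σ y = b (q y) ⊗ₜ[ℂ] c (r y)) (X : TangentSpace 𝓘(ℝ, E) x) :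
    chernDeriv H f x X • σ x =
      chernFun hB b (q x) (mfderiv 𝓘(ℝ, E) 𝓘(ℝ, E) q x X) ⊗ₜ[ℂ] c (r x) +
        b (q x) ⊗ₜ[ℂ] chernFun hC c (r x) (mfderiv 𝓘(ℝ, E) 𝓘(ℝ, E) r x X) := by
  have hv := B.mem_frameSet (q x)
  have hw := C.mem_frameSet (r x)
  have hq' := hq.mdifferentiableAt (by simp)
  have hr' := hr.mdifferentiableAt (by simp)
  obtain ⟨k, hk, hks⟩ := exists_tmul_eq_smul_frame_tmul_frame hq hr hv hw hs hs'
  have hσk := hσ.and hks |>.mono fun _ h ↦ h.1.trans h.2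
  rw [chernFun_tmul_add_tmul_chernFun hq' hr' hv hw hb hc]
  refine chernDeriv_smul_eq_of_smul_eq hk
    ((mdifferentiableAt_frameNorm_comp hq' hv).mul (mdifferentiableAt_frameNorm_comp hr' hw))
    (mul_ne_zero (frameNorm_ne_zero hv) (frameNorm_ne_zero hw)) hf hσk hσ0 ?_ ?_ X
  · filter_upwards [hH, hσk] with y hy hky
    rw [hy, hky, tensorForm_smul_tmul_self]
    rfl
  · filter_upwards [hfσ, hq.continuousAt (frameSet_mem_nhds hv),
      hr.continuousAt (frameSet_mem_nhds hw)] with y hy hyv hyw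
    rw [hy, coord_mul_coord_smul_frame_tmul_frame hyv hyw]

end TensorProduct

variable [IsManifold 𝓘(ℂ, E) ω M₁] [IsManifold 𝓘(ℂ, E) ω M₂] [IsManifold 𝓘(ℂ, E) ω M₃]
  [IsManifold 𝓘(ℂ, E) ω M₄]

theorem TensorIso.IsUnitary.isParallel {φ : TensorIso p A q B r C} (hφ : φ.IsUnitary hA hB hC)
    (hp : ContMDiff 𝓘(ℂ, E) 𝓘(ℂ, E) ω p) (hq : ContMDiff 𝓘(ℂ, E) 𝓘(ℂ, E) ω q)
    (hr : ContMDiff 𝓘(ℂ, E) 𝓘(ℂ, E) ω r) :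
    φ.IsParallel (chernConnection hA) (chernConnection hB) (chernConnection hC) := by
  intro x a b c ha hb hc habc X
  have hu := A.mem_frameSet (p x)
  have hp' := (hp x).mdifferentiableAt (by simp)
  have hframe := hp.continuous.continuousAt (frameSet_mem_nhds hu)
  obtain ⟨s, s', hs, hs', hφs⟩ := φ.holomorphic x _ (holAlong_frame (hp x) hu)
  refine (congrArg (φ.equiv x) (chernFun_comp_apply hp' hu ha X)).trans ?_
  rw [map_smul]
  refine chernDeriv_smul_eq_chernFun_tmul (σ := fun y ↦ φ.equiv y (A.frame (p x) (p y)))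
    (hq x) (hr x) hb hc hs hs' hφs ?_ ?_ (mdifferentiableAt_coord_comp hp' hu ha) ?_ X
  · filter_upwards [hframe] with y hy using (φ.equiv y).map_ne_zero_iff.2 (frame_ne_zero hy)
  · exact .of_forall fun y ↦ (hφ y _ _).symm
  · filter_upwards [hframe, habc] with y hy hφy
    rw [← map_smul, coord_smul_frame hy, hφy]

theorem TensorIso₂.IsUnitary.isParallel {φ : TensorIso₂ p A q B r C t D}
    (hφ : φ.IsUnitary hA hB hC hD) (hp : ContMDiff 𝓘(ℂ, E) 𝓘(ℂ, E) ω p)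
    (hq : ContMDiff 𝓘(ℂ, E) 𝓘(ℂ, E) ω q) (hr : ContMDiff 𝓘(ℂ, E) 𝓘(ℂ, E) ω r)
    (ht : ContMDiff 𝓘(ℂ, E) 𝓘(ℂ, E) ω t) :
    φ.IsParallel (chernConnection hA) (chernConnection hB) (chernConnection hC)
      (chernConnection hD) := by
  intro x a b c d ha hb hc hd habcd X
  have hu := A.mem_frameSet (p x)
  have hv := B.mem_frameSet (q x)
  have hp' := (hp x).mdifferentiableAt (by simp)
  have hq' := (hq x).mdifferentiableAt (by simp)
  have hframe := hp.continuous.continuousAt (frameSet_mem_nhds hu)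
  have hframe' := hq.continuous.continuousAt (frameSet_mem_nhds hv)
  obtain ⟨s, s', hs, hs', hφs⟩ :=
    φ.holomorphic x _ _ (holAlong_frame (hp x) hu) (holAlong_frame (hq x) hv)
  refine (congrArg (φ.equiv x)
    (chernFun_tmul_add_tmul_chernFun hp' hq' hu hv ha hb X)).trans ?_
  rw [map_smul]
  refine chernDeriv_smul_eq_chernFun_tmul
    (σ := fun y ↦ φ.equiv y (A.frame (p x) (p y) ⊗ₜ[ℂ] B.frame (q x) (q y)))
    (f := fun y ↦ A.coord (p x) (p y) (a (p y)) * B.coord (q x) (q y) (b (q y)))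
    (hr x) (ht x) hc hd hs hs' hφs ?_ ?_
    ((mdifferentiableAt_coord_comp hp' hu ha).mul (mdifferentiableAt_coord_comp hq' hv hb)) ?_ X
  · filter_upwards [hframe, hframe'] with y hy hy'
      using (φ.equiv y).map_ne_zero_iff.2 (frame_tmul_frame_ne_zero hy hy')
  · exact .of_forall fun y ↦ (tensorForm_tmul _ _ _ _ _ _).symm.trans
      (hφ y (_ ⊗ₜ[ℂ] _) (_ ⊗ₜ[ℂ] _)).symm
  · filter_upwards [hframe, hframe', habcd] with y hy hy' hφy
    rw [← map_smul, coord_mul_coord_smul_frame_tmul_frame hy hy', hφy]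

end Parallel

section Cover

variable {E : Type*} [NormedAddCommGroup E] [NormedSpace ℂ E]
  {X : Type*} [TopologicalSpace X] [ChartedSpace E X]

theorem contMDiff_into_opens {U W : Opens X} {f : U → W}
    (hf : ContMDiff 𝓘(ℂ, E) 𝓘(ℂ, E) ω (fun x ↦ (f x : X))) :
    ContMDiff 𝓘(ℂ, E) 𝓘(ℂ, E) ω f :=
  fun x ↦ (ChartedSpace.liftPropWithinAt_subtypeVal_comp_iff f Set.univ x).1 (hf x)

variable {G I : Type*} [Group G] [MulAction G X] [MulAction G I]

section Action

variable (hG : ∀ g : G, ContMDiff 𝓘(ℂ, E) 𝓘(ℂ, E) ω (fun x : X ↦ g • x))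
include hG

theorem contMDiff_translate (𝒰 : InvariantCover G X I) (g : G) (a : I) :
    ContMDiff 𝓘(ℂ, E) 𝓘(ℂ, E) ω (translate 𝒰 g a) :=
  contMDiff_into_opens ((hG g⁻¹).comp contMDiff_subtype_val)

theorem contMDiff_translate₂ (𝒰 : InvariantCover G X I) (g : G) (a b : I) :
    ContMDiff 𝓘(ℂ, E) 𝓘(ℂ, E) ω (translate₂ 𝒰 g a b) :=
  contMDiff_into_opens ((hG g⁻¹).comp contMDiff_subtype_val)

end Action

variable [IsManifold 𝓘(ℂ, E) ω X] {𝒰 : InvariantCover G X I} {𝒢 : EquivariantGerbe E 𝒰}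

section Existence

variable (hG : ∀ g : G, ContMDiff 𝓘(ℂ, E) 𝓘(ℂ, E) ω (fun x : X ↦ g • x))
  (h : EquivariantHermitianStructure 𝒢)

/-- The connective structure given by the Chern connections. -/
def chernConnectiveStructure : ConnectiveStructure 𝒢 where
  conn a b := chernConnection (h.metric a b)
  connG g a := chernConnection (h.metricG g a)
  parallel₀ a b c := (h.unitary₀ a b c).isParallel (contMDiff_into_opens contMDiff_subtype_val)
    (contMDiff_into_opens contMDiff_subtype_val) (contMDiff_into_opens contMDiff_subtype_val)
  parallel₁ g a b := (h.unitary₁ g a b).isParallel (contMDiff_translate₂ hG 𝒰 g a b)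
    (contMDiff_into_opens contMDiff_subtype_val) (contMDiff_into_opens contMDiff_subtype_val)
    contMDiff_id
  parallel₂ g₁ g₂ a := (h.unitary₂ g₁ g₂ a).isParallel contMDiff_id contMDiff_id
    (contMDiff_translate hG 𝒰 g₁ a)

theorem isCompatible_chernConnectiveStructure : (chernConnectiveStructure hG h).IsCompatible h where
  preservesMetric _ _ := preservesMetric_chernConnection
  preservesMetricG _ _ := preservesMetric_chernConnection
  holCompatible _ _ := isHolCompatible_chernConnection
  holCompatibleG _ _ := isHolCompatible_chernConnection

end Existence

theorem ConnectiveStructure.IsCompatible.eq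
    {h : EquivariantHermitianStructure 𝒢} {D D' : ConnectiveStructure 𝒢} (hD : D.IsCompatible h)
    (hD' : D'.IsCompatible h) : D = D' := by
  have hconn : D.conn = D'.conn := by
    funext a b
    rw [(D.conn a b).eq_chernConnection (hD.preservesMetric a b) (hD.holCompatible a b),
      (D'.conn a b).eq_chernConnection (hD'.preservesMetric a b) (hD'.holCompatible a b)]
  have hconnG : D.connG = D'.connG := by
    funext g a
    rw [(D.connG g a).eq_chernConnection (hD.preservesMetricG g a) (hD.holCompatibleG g a),
      (D'.connG g a).eq_chernConnection (hD'.preservesMetricG g a) (hD'.holCompatibleG g a)]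
  obtain ⟨conn, connG, _, _, _⟩ := D
  subst hconn hconnG
  rfl

end Cover

end HermGerbe

theorem mainTheorem9_general {E : Type u} [NormedAddCommGroup E] [NormedSpace ℂ E]
    {X : Type v} [TopologicalSpace X] [ChartedSpace E X] [IsManifold 𝓘(ℂ, E) ω X]
    {G : Type v₁} [Group G] [MulAction G X]
    (hG : ∀ g : G, ContMDiff 𝓘(ℂ, E) 𝓘(ℂ, E) ω (fun x : X ↦ g • x))
    {I : Type v₂} [MulAction G I] (𝒰 : HermGerbe.InvariantCover G X I)
    (𝒢 : HermGerbe.EquivariantGerbe.{u, v, w} E 𝒰)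
    (h : HermGerbe.EquivariantHermitianStructure 𝒢) :
    ∃! D : HermGerbe.ConnectiveStructure 𝒢, D.IsCompatible h :=
  have hchern := HermGerbe.isCompatible_chernConnectiveStructure hG h
  ⟨HermGerbe.chernConnectiveStructure hG h, hchern, fun _ hD ↦ hD.eq hchern⟩

theorem mainTheorem9 {E : Type u} [NormedAddCommGroup E] [NormedSpace ℂ E] [FiniteDimensional ℂ E]
    {X : Type v} [TopologicalSpace X] [ChartedSpace E X] [IsManifold 𝓘(ℂ, E) ω X]
    {G : Type v₁} [Group G] [MulAction G X]
    (hG : ∀ g : G, ContMDiff 𝓘(ℂ, E) 𝓘(ℂ, E) ω (fun x : X ↦ g • x))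
    {I : Type v₂} [MulAction G I] (𝒰 : HermGerbe.InvariantCover G X I)
    (𝒢 : HermGerbe.EquivariantGerbe.{u, v, w} E 𝒰)
    (h : HermGerbe.EquivariantHermitianStructure 𝒢) :
    ∃! D : HermGerbe.ConnectiveStructure 𝒢, D.IsCompatible h :=
  mainTheorem9_general hG 𝒰 𝒢 h
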